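/- Let $(\Omega,\mathcal F,\mathbb P)$ be a probability space, $X:\Omega\to\mathbb R^d$ and $Y:\Omega\to\mathbb R^p$ random variables, and $f:\mathbb R^p\to\mathbb R$ measurable with $\mathbb E[f(Y)^2]<\infty$. For $\theta\in\mathbb R^q$ let $\varphi(\theta,\cdot):\mathbb R^d\to\mathbb R$ be measurable with $\mathbb E[\varphi(\theta,X)^2]<\infty$. Let $(Y^{(k)})_{k\ge1}$ be, conditionally on $X$, i.i.d. with law $\mathcal L(Y\mid X)$, and let $(X_i,(Y_i^{(k)})_{k\ge1})_{i\ge1}$ be i.i.d. copies of $(X,(Y^{(k)})_{k\ge1})$. Fix $K\ge1$ and put, for $N\ge1$, $$v^\infty(\theta)=\mathbb E\big[(\varphi(\theta,X)-\mathbb E[f(Y)|X])^2\big],\qquad v_N^K(\theta)=\frac1N\sum_{i=1}^N\Big(\varphi(\theta,X_i)-\frac1K\sum_{k=1}^Kf(Y_i^{(k)})\Big)^2 .$$ Let $C\subset\mathbb R^q$ be a convex compact set with non-empty interior $\mathring C$. Gradients and Hessians are taken with respect to $\theta$. Assume: 1. $\mathbb E[\sup_{\theta\in C}|\varphi(\theta,X)|^2]<\infty$;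 2. for almost every $x$ with respect to the law of $X$, $\theta\mapsto\varphi(\theta,x)$ is continuous on $C$; 3. $v^\infty$ has a unique minimizer $\theta^\star$ on $C$, and $\theta^\star\in\mathring C$; 4. for almost every $x$ with respect to the law of $X$, $\theta\mapsto\varphi(\theta,x)$ is twice continuously differentiable on $C$; moreover $\mathbb E[\sup_{\theta\in C}|\nabla\varphi(\theta,X)|^2]<\infty$ and $\mathbb E[\sup_{\theta\in C}|\nabla^2\varphi(\theta,X)|^2]<\infty$; 5. $\mathbb E\big[\big(\varphi(\theta^\star,X)-\frac1K\sum_{k=1}^Kf(Y^{(k)})\big)^2|\nabla\varphi(\theta^\star,X)|^2\big]<\infty$; 6. the matrix $H=\nabla^2v^\infty(\theta^\star)$ is positive definite. For each $N\ge1$ let $\theta_N^K$ be a random variable that almost surely lies in $C$ and minimizes $v_N^K$ over $C$. Let $$\Gamma^K=\mathbb E\Big[\Big(\varphi(\theta^\star,X)-\frac1K\sum_{k=1}^Kf(Y^{(k)})\Big)^2\nabla\varphi(\theta^\star,X)\nabla\varphi(\theta^\star,X)^T\Big].$$ Then $\Gamma^K=A+B/K$, where $$A=\mathbb E\big[(\varphi(\theta^\star,X)-\mathbb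 E[f(Y)|X])^2\,\nabla\varphi(\theta^\star,X)\nabla\varphi(\theta^\star,X)^T\big],\quad B=\mathbb E\big[(f(Y)-\mathbb E[f(Y)|X])^2\,\nabla\varphi(\theta^\star,X)\nabla\varphi(\theta^\star,X)^T\big],$$ and, as $N\to\infty$, $$N\big(v_N^K(\theta^\star)-v_N^K(\theta_N^K)\big)\xrightarrow{\ \mathcal L\ }2\,G^THG\quad\text{and}\quad N\big(v^\infty(\theta_N^K)-v^\infty(\theta^\star)\big)\xrightarrow{\ \mathcal L\ }2\,G^THG,$$ where $G\sim\mathcal N(0,H^{-1}\Gamma^KH^{-1})$. -/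

import Mathlib

open MeasureTheory ProbabilityTheory Filter Topology

noncomputable section

namespace NestedRegression

variable {Ω : Type*} [MeasurableSpace Ω] {d p q : ℕ}

/-- The mean of `f` over the first `K` inner samples, `(1/K) ∑_{k < K} f (y k)`. -/
def innerMean (K : ℕ) (f : EuclideanSpace ℝ (Fin p) → ℝ)
    (y : ℕ → EuclideanSpace ℝ (Fin p)) : ℝ :=
  (K : ℝ)⁻¹ * ∑ k ∈ Finset.range K, f (y k)

/-- The conditional expectation `E[f(Y) | X]`, as a function on `Ω`. -/
def condMean (P : Measure Ω) (X : Ω → EuclideanSpace ℝ (Fin d))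
    (Y : Ω → EuclideanSpace ℝ (Fin p)) (f : EuclideanSpace ℝ (Fin p) → ℝ) : Ω → ℝ :=
  P[fun ω => f (Y ω) | MeasurableSpace.comap X inferInstance]

/-- `v^∞(θ) = E[(φ(θ, X) - E[f(Y) | X])²]`. -/
def vInf (P : Measure Ω) (X : Ω → EuclideanSpace ℝ (Fin d))
    (Y : Ω → EuclideanSpace ℝ (Fin p)) (f : EuclideanSpace ℝ (Fin p) → ℝ)
    (φ : EuclideanSpace ℝ (Fin q) → EuclideanSpace ℝ (Fin d) → ℝ)
    (θ : EuclideanSpace ℝ (Fin q)) : ℝ :=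
  ∫ ω, (φ θ (X ω) - condMean P X Y f ω) ^ 2 ∂P

/-- `v_N^K(θ) = (1/N) ∑_{i < N} (φ(θ, X_i) - (1/K) ∑_{k < K} f(Y_i^{(k)}))²`, at the
outcome `ω`. -/
def vEmp (f : EuclideanSpace ℝ (Fin p) → ℝ)
    (φ : EuclideanSpace ℝ (Fin q) → EuclideanSpace ℝ (Fin d) → ℝ)
    (Xs : ℕ → Ω → EuclideanSpace ℝ (Fin d)) (Ys : ℕ → ℕ → Ω → EuclideanSpace ℝ (Fin p))
    (K N : ℕ) (ω : Ω) (θ : EuclideanSpace ℝ (Fin q)) : ℝ :=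
  (N : ℝ)⁻¹ * ∑ i ∈ Finset.range N,
    (φ θ (Xs i ω) - innerMean K f (fun k => Ys i k ω)) ^ 2

/-- Given `X`, the sequence `Yc 0, Yc 1, …` is i.i.d. with law `L(Y | X)`: a version of the
conditional law of the sequence given `X = x` is the product measure `L(Y | X = x)^{⊗ ℕ}`. -/
structure IsCondIID (P : Measure Ω) [IsFiniteMeasure P] (X : Ω → EuclideanSpace ℝ (Fin d))
    (Y : Ω → EuclideanSpace ℝ (Fin p)) (Yc : ℕ → Ω → EuclideanSpace ℝ (Fin p)) : Prop where
  measurable : ∀ k, Measurable (Yc k)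
  condLaw : ∀ᵐ x ∂(P.map X), condDistrib (fun ω k => Yc k ω) X P x =
    Measure.infinitePi (fun _ : ℕ => condDistrib Y X P x)

/-- The samples `(X_i, (Y_i^{(k)})_k)` are i.i.d. copies of `(X, (Y^{(k)})_k)`. -/
structure IsIIDCopies (P : Measure Ω) (X : Ω → EuclideanSpace ℝ (Fin d))
    (Yc : ℕ → Ω → EuclideanSpace ℝ (Fin p)) (Xs : ℕ → Ω → EuclideanSpace ℝ (Fin d))
    (Ys : ℕ → ℕ → Ω → EuclideanSpace ℝ (Fin p)) : Prop where
  measurable_outer : ∀ i, Measurable (Xs i)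
  measurable_inner : ∀ i k, Measurable (Ys i k)
  indep : iIndepFun (fun i ω => (Xs i ω, fun k => Ys i k ω)) P
  identDistrib : ∀ i,
    IdentDistrib (fun ω => (Xs i ω, fun k => Ys i k ω)) (fun ω => (X ω, fun k => Yc k ω)) P P

/-- The Hessian matrix of `g` at `θ`. -/
def hessian (g : EuclideanSpace ℝ (Fin q) → ℝ) (θ : EuclideanSpace ℝ (Fin q)) :
    Matrix (Fin q) (Fin q) ℝ :=
  Matrix.of fun i j => iteratedFDeriv ℝ 2 g θ
    ![EuclideanSpace.single i (1 : ℝ), EuclideanSpace.single j (1 : ℝ)]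

/-- The gradient `∇φ(θ, x)` with respect to the parameter `θ`. -/
def gradParam (φ : EuclideanSpace ℝ (Fin q) → EuclideanSpace ℝ (Fin d) → ℝ)
    (θ : EuclideanSpace ℝ (Fin q)) (x : EuclideanSpace ℝ (Fin d)) :
    EuclideanSpace ℝ (Fin q) :=
  gradient (fun η => φ η x) θ

/-- The matrix `E[W² ∇φ(θ, X) ∇φ(θ, X)ᵀ]` for a real random variable `W`. -/
def weightedGram (P : Measure Ω) (X : Ω → EuclideanSpace ℝ (Fin d))
    (φ : EuclideanSpace ℝ (Fin q) → EuclideanSpace ℝ (Fin d) → ℝ)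
    (θ : EuclideanSpace ℝ (Fin q)) (W : Ω → ℝ) : Matrix (Fin q) (Fin q) ℝ :=
  Matrix.of fun i j =>
    ∫ ω, W ω ^ 2 * (gradParam φ θ (X ω) i * gradParam φ θ (X ω) j) ∂P

/-- `Γ^K = E[(φ(θ, X) - (1/K) ∑_{k < K} f(Y^{(k)}))² ∇φ(θ, X) ∇φ(θ, X)ᵀ]`. -/
def matΓ (P : Measure Ω) (X : Ω → EuclideanSpace ℝ (Fin d))
    (Yc : ℕ → Ω → EuclideanSpace ℝ (Fin p)) (f : EuclideanSpace ℝ (Fin p) → ℝ)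
    (φ : EuclideanSpace ℝ (Fin q) → EuclideanSpace ℝ (Fin d) → ℝ)
    (K : ℕ) (θ : EuclideanSpace ℝ (Fin q)) : Matrix (Fin q) (Fin q) ℝ :=
  weightedGram P X φ θ (fun ω => φ θ (X ω) - innerMean K f (fun k => Yc k ω))

/-- `A = E[(φ(θ, X) - E[f(Y) | X])² ∇φ(θ, X) ∇φ(θ, X)ᵀ]`. -/
def matA (P : Measure Ω) (X : Ω → EuclideanSpace ℝ (Fin d))
    (Y : Ω → EuclideanSpace ℝ (Fin p)) (f : EuclideanSpace ℝ (Fin p) → ℝ)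
    (φ : EuclideanSpace ℝ (Fin q) → EuclideanSpace ℝ (Fin d) → ℝ)
    (θ : EuclideanSpace ℝ (Fin q)) : Matrix (Fin q) (Fin q) ℝ :=
  weightedGram P X φ θ (fun ω => φ θ (X ω) - condMean P X Y f ω)

/-- `B = E[(f(Y) - E[f(Y) | X])² ∇φ(θ, X) ∇φ(θ, X)ᵀ]`. -/
def matB (P : Measure Ω) (X : Ω → EuclideanSpace ℝ (Fin d))
    (Y : Ω → EuclideanSpace ℝ (Fin p)) (f : EuclideanSpace ℝ (Fin p) → ℝ)
    (φ : EuclideanSpace ℝ (Fin q) → EuclideanSpace ℝ (Fin d) → ℝ)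
    (θ : EuclideanSpace ℝ (Fin q)) : Matrix (Fin q) (Fin q) ℝ :=
  weightedGram P X φ θ (fun ω => f (Y ω) - condMean P X Y f ω)

/-- The quadratic form `g ↦ 2 gᵀ H g`. -/
def twiceQuadForm (H : Matrix (Fin q) (Fin q) ℝ) (g : EuclideanSpace ℝ (Fin q)) : ℝ :=
  2 * (g.ofLp ⬝ᵥ (H.mulVec g.ofLp))

end NestedRegression

end

/-! Conditionally on `X`, the inner mean of `K` samples has mean `E[f(Y)|X]` and variance
`Var(f(Y)|X)/K`. Integrating the squared residual against any weight depending on `X` therefore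
splits it into a bias term and a variance term divided by `K`
(`integral_weighted_sub_innerMean_sq`). With weight `∂ᵢφ ∂ⱼφ` this is `Γ = A + B/K`. With weight 1
it says that the mean of the sampled loss is `v^∞` plus a constant, so minimizer, Hessian and excess
values are those of `v^∞`, and the rest is a statement about minimizers of empirical means of a
smooth loss.

Put `h₀ = -H⁻¹ ∇v_N(θ*)`. Almost surely, `v_N(θ* + h) - v_N(θ*) = -hᵀH h₀ + hᵀH h / 2 + o(|h|²)`,
where the error is small uniformly in large `N` as `h → 0` (`ae_average_taylor`). This uniformity
comes from the strong law applied to integrable envelopes of Taylor remainders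
(`ae_eventually_average_le`). The minimizer is consistent (`ae_tendsto_argmin`), and comparing its
value with that of the competitor `θ* + h₀` forces `θ_N - θ* = h₀ + o(|h₀|)`
(`exists_perturbed_argmin_bound`). Hence both excess losses equal `h₀ᵀH h₀ / 2 + o(|h₀|²)`
(`ae_excess_loss_approx`).

The gradient of the squared residual is twice residual times `∇φ`, so by the central limit theorem
`√N h₀` converges in law to `2G`. Multiplying by `N`, the limit is `(2G)ᵀH(2G)/2 = 2 GᵀHG`; the
remainder, quadratic in a sequence converging in law, vanishes by Slutsky
(`tendstoInDistribution_of_abs_sub_le`). -/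

namespace NestedRegression

/-! ### Measurable envelopes -/

/-- A family that is continuous in the parameter on `T` has a measurable envelope on `T` which does
not exceed the pointwise supremum. -/
lemma exists_aemeasurable_envelope {𝒯 α F : Type*} [TopologicalSpace 𝒯]
    [SecondCountableTopology 𝒯] [MeasurableSpace α] {μ : Measure α} [NormedAddCommGroup F]
    (G : 𝒯 → α → F) (T : Set 𝒯) (hG : ∀ t ∈ T, AEStronglyMeasurable (G t) μ) :
    ∃ g : α → ENNReal, AEMeasurable g μ ∧ (∀ z, g z ≤ ⨆ t ∈ T, ‖G t z‖ₑ) ∧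
      ∀ z, ContinuousOn (fun t => G t z) T → ∀ t ∈ T, ‖G t z‖ₑ ≤ g z := by
  -- A supremum over a countable dense subset of `T` is measurable; where the family is continuous,
  -- the bound it gives is a closed condition on `t` and so extends to all of `T`.
  obtain ⟨D, hDc, hDd⟩ := TopologicalSpace.exists_countable_dense T
  refine ⟨fun z => ⨆ t ∈ D, ‖G (t : 𝒯) z‖ₑ, ?_, ?_, ?_⟩
  · exact AEMeasurable.biSup _ hDc fun t _ => (hG t t.2).enorm
  · intro z
    refine iSup₂_le fun t _ => ?_
    exact le_iSup₂ (f := fun (t : 𝒯) (_ : t ∈ T) => ‖G t z‖ₑ) (t : 𝒯) t.2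
  · intro z hz t ht
    have hc : Continuous fun t : T => ‖G (t : 𝒯) z‖ₑ :=
      (continuousOn_iff_continuous_domRestrict.1 hz).enorm
    have hcl : IsClosed {t : T | ‖G (t : 𝒯) z‖ₑ ≤ ⨆ t ∈ D, ‖G (t : 𝒯) z‖ₑ} :=
      isClosed_le hc continuous_const
    have hsub : D ⊆ {t : T | ‖G (t : 𝒯) z‖ₑ ≤ ⨆ t ∈ D, ‖G (t : 𝒯) z‖ₑ} := fun t ht =>
      le_iSup₂ (f := fun (t : T) (_ : t ∈ D) => ‖G (t : 𝒯) z‖ₑ) t ht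
    have := hcl.closure_subset_iff.2 hsub (hDd ⟨t, ht⟩)
    exact this

/-- The supremum over an uncountable parameter set may fail to be measurable. A measurable envelope
of the squared norms lies below `s`, and its square root is a genuine dominating function in L². -/
lemma exists_memLp_two_bound {𝒯 α F : Type*} [TopologicalSpace 𝒯]
    [SecondCountableTopology 𝒯] [MeasurableSpace α] {μ : Measure α} [NormedAddCommGroup F]
    (G : 𝒯 → α → F) (T : Set 𝒯) (hG : ∀ t ∈ T, AEStronglyMeasurable (G t) μ)
    (hc : ∀ᵐ z ∂μ, ContinuousOn (fun t => G t z) T)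
    {s : α → ENNReal} (hs : ∀ᵐ z ∂μ, ∀ t ∈ T, ‖G t z‖ₑ ^ 2 ≤ s z) (hs' : ∫⁻ z, s z ∂μ < ⊤) :
    ∃ b : α → ℝ, MemLp b 2 μ ∧ (∀ z, 0 ≤ b z) ∧ ∀ᵐ z ∂μ, ∀ t ∈ T, ‖G t z‖ ≤ b z := by
  obtain ⟨g, hgm, hgle, hgb⟩ := exists_aemeasurable_envelope (μ := μ)
    (fun t z => ‖G t z‖ ^ 2) T (fun t ht => (hG t ht).norm.pow 2)
  have hint : ∫⁻ z, g z ∂μ ≠ ⊤ := by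
    refine ne_top_of_le_ne_top hs'.ne (lintegral_mono_ae ?_)
    filter_upwards [hs] with z hz
    refine (hgle z).trans (iSup₂_le fun t ht => ?_)
    simpa using hz t ht
  have hfin := ae_lt_top' hgm hint
  refine ⟨fun z => √(g z).toReal, ?_, fun z => Real.sqrt_nonneg _, ?_⟩
  · have hm : AEMeasurable (fun z => √(g z).toReal) μ := hgm.ennreal_toReal.sqrt
    rw [memLp_two_iff_integrable_sq hm.aestronglyMeasurable]
    simp_rw [Real.sq_sqrt ENNReal.toReal_nonneg]
    exact integrable_toReal_of_lintegral_ne_top hgm hint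
  · filter_upwards [hc, hfin] with z hz hzf t ht
    have h1 := hgb z (hz.norm.pow 2) t ht
    apply Real.le_sqrt_of_sq_le
    have h2 := ENNReal.toReal_mono hzf.ne h1
    simpa using h2

/-- A dominated family that becomes uniformly small along sets `T n` has envelopes on `T n` of
arbitrarily small integral. -/
lemma exists_envelope_integral_le {𝒯 α : Type*} [TopologicalSpace 𝒯]
    [SecondCountableTopology 𝒯] [MeasurableSpace α] {μ : Measure α}
    (G : 𝒯 → α → ℝ) (T : ℕ → Set 𝒯) (hG : ∀ n, ∀ t ∈ T n, AEStronglyMeasurable (G t) μ)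
    (hc : ∀ᵐ z ∂μ, ∀ n, ContinuousOn (fun t => G t z) (T n))
    {b : α → ℝ} (hb : Integrable b μ) (hGb : ∀ᵐ z ∂μ, ∀ n, ∀ t ∈ T n, |G t z| ≤ b z)
    (hlim : ∀ᵐ z ∂μ, ∀ ε > 0, ∀ᶠ n in atTop, ∀ t ∈ T n, |G t z| ≤ ε) {ε : ℝ} (hε : 0 < ε) :
    ∃ n, ∃ g : α → ℝ, Integrable g μ ∧ (∀ᵐ z ∂μ, ∀ t ∈ T n, |G t z| ≤ g z) ∧
      ∫ z, g z ∂μ ≤ ε := by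
  choose g hgm hgle hgb using fun n => exists_aemeasurable_envelope (μ := μ) G (T n) (hG n)
  have hgB : ∀ᵐ z ∂μ, ∀ n, g n z ≤ ENNReal.ofReal (b z) := by
    filter_upwards [hGb] with z hz n
    refine (hgle n z).trans (iSup₂_le fun t ht => ?_)
    rw [← ofReal_norm]
    exact ENNReal.ofReal_le_ofReal (hz n t ht)
  have hB : ∫⁻ z, ENNReal.ofReal (b z) ∂μ ≠ ⊤ := hb.lintegral_lt_top.ne
  have hlim' : ∀ᵐ z ∂μ, Tendsto (fun n => g n z) atTop (𝓝 0) := by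
    filter_upwards [hlim] with z hz
    rw [ENNReal.tendsto_nhds_zero]
    intro η hη
    rcases eq_or_ne η ⊤ with rfl | hη'
    · simp
    filter_upwards [hz η.toReal (ENNReal.toReal_pos hη.ne' hη')] with n hn
    refine (hgle n z).trans (iSup₂_le fun t ht => ?_)
    rw [← ofReal_norm, ← ENNReal.ofReal_toReal hη']
    exact ENNReal.ofReal_le_ofReal (hn t ht)
  -- Dominated convergence is applied to the envelopes themselves, which tend to 0 because they lie
  -- below the pointwise suprema.
  have ht := tendsto_lintegral_of_dominated_convergence' (f := fun _ => 0) _ hgm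
    (fun n => hgB.mono fun z hz => hz n) hB hlim'
  simp only [lintegral_zero] at ht
  obtain ⟨n, hn⟩ := (ENNReal.tendsto_nhds_zero.1 ht (ENNReal.ofReal ε)
    (ENNReal.ofReal_pos.2 hε)).exists
  have hne : ∫⁻ z, g n z ∂μ ≠ ⊤ := ne_top_of_le_ne_top ENNReal.ofReal_ne_top hn
  refine ⟨n, fun z => (g n z).toReal, integrable_toReal_of_lintegral_ne_top (hgm n) hne, ?_, ?_⟩
  · filter_upwards [hc, ae_lt_top' (hgm n) hne] with z hz hzf t ht
    have h2 := ENNReal.toReal_mono hzf.ne (hgb n z (hz n) t ht)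
    simpa using h2
  · rw [integral_toReal (hgm n) (ae_lt_top' (hgm n) hne)]
    exact ENNReal.toReal_le_of_le_ofReal hε.le hn

/-! ### Measurability of derivatives with respect to a parameter -/

/-- Each directional derivative is an almost everywhere limit of difference quotients, and in finite
dimension the derivative is a linear combination of its values on the standard basis. -/
lemma aestronglyMeasurable_fderiv_param {q : ℕ} {α F : Type*} [MeasurableSpace α] {μ : Measure α}
    [NormedAddCommGroup F] [NormedSpace ℝ F] (G : EuclideanSpace ℝ (Fin q) → α → F)
    {U : Set (EuclideanSpace ℝ (Fin q))} {θ : EuclideanSpace ℝ (Fin q)} (hU : U ∈ 𝓝 θ)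
    (hG : ∀ t ∈ U, AEStronglyMeasurable (G t) μ)
    (hd : ∀ᵐ z ∂μ, DifferentiableAt ℝ (fun t => G t z) θ) :
    AEStronglyMeasurable (fun z => fderiv ℝ (fun t => G t z) θ) μ := by
  have hdir : ∀ v : EuclideanSpace ℝ (Fin q),
      AEStronglyMeasurable (fun z => fderiv ℝ (fun t => G t z) θ v) μ := by
    intro v
    have hev : ∀ᶠ n : ℕ in atTop, θ + ((n : ℝ) + 1)⁻¹ • v ∈ U := by
      have : Tendsto (fun n : ℕ => θ + ((n : ℝ) + 1)⁻¹ • v) atTop (𝓝 (θ + (0 : ℝ) • v)) := by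
        refine tendsto_const_nhds.add (Tendsto.smul_const ?_ v)
        simpa using tendsto_one_div_add_atTop_nhds_zero_nat (𝕜 := ℝ)
      simp only [zero_smul, add_zero] at this
      exact this hU
    -- Starting the quotients at `n₀` keeps every evaluation point in `U`, where measurability is
    -- known.
    obtain ⟨n₀, hn₀⟩ := eventually_atTop.1 hev
    refine aestronglyMeasurable_of_tendsto_ae (u := atTop)
      (f := fun (n : ℕ) z => (((n + n₀ : ℕ) : ℝ) + 1) •
        (G (θ + (((n + n₀ : ℕ) : ℝ) + 1)⁻¹ • v) z - G θ z)) ?_ ?_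
    · intro n
      exact ((hG _ (hn₀ _ (Nat.le_add_left _ _))).sub (hG θ (mem_of_mem_nhds hU))).const_smul _
    · filter_upwards [hd] with z hz
      have h1 : Tendsto (fun n : ℕ => ‖((n + n₀ : ℕ) : ℝ) + 1‖) atTop atTop := by
        have h1 : Tendsto (fun n : ℕ => ((n : ℝ) + 1)) atTop atTop :=
          tendsto_atTop_add_const_right _ _ tendsto_natCast_atTop_atTop
        exact tendsto_norm_atTop_atTop.comp (h1.comp (tendsto_add_atTop_nat n₀))
      exact hz.hasFDerivAt.lim v h1
  have hrep : (fun z => fderiv ℝ (fun t => G t z) θ) = fun z =>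
      ∑ i : Fin q, ContinuousLinearMap.smulRightL ℝ (EuclideanSpace ℝ (Fin q)) F
        (EuclideanSpace.proj i) (fderiv ℝ (fun t => G t z) θ (EuclideanSpace.single i 1)) := by
    funext z
    ext v
    simp only [sum_apply, ContinuousLinearMap.smulRightL_apply_apply]
    conv_lhs => rw [← (EuclideanSpace.basisFun (Fin q) ℝ).sum_repr v]
    simp [map_sum]
  rw [hrep]
  refine Finset.aestronglyMeasurable_fun_sum _ fun i _ => ?_
  exact (ContinuousLinearMap.continuous _).comp_aestronglyMeasurable (hdir _)

/-! ### Evaluation of a Carathéodory family at a random parameter -/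

/-- Needed because the minimizer is inserted into a loss known to be measurable only for each fixed
parameter. Continuity in the parameter gives joint measurability, once null sets are removed and the
random parameter is replaced by a measurable version with values in `C`. -/
lemma aemeasurable_eval_random_param {E Ω S : Type*} [TopologicalSpace E]
    [TopologicalSpace.MetrizableSpace E] [SecondCountableTopology E] [MeasurableSpace E]
    [BorelSpace E] [MeasurableSpace Ω] [MeasurableSpace S]
    {P : Measure Ω} {μ : Measure S} {m : E → S → ℝ} {C : Set E} (hC : MeasurableSet C)
    (hCne : C.Nonempty) (hm : ∀ θ ∈ C, Measurable (m θ))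
    (hc : ∀ᵐ z ∂μ, ContinuousOn (fun θ => m θ z) C)
    {Z : Ω → S} (hZ : MeasurePreserving Z P μ) {t : Ω → E} (ht : AEMeasurable t P)
    (htC : ∀ᵐ ω ∂P, t ω ∈ C) : AEMeasurable (fun ω => m (t ω) (Z ω)) P := by
  obtain ⟨θ₀, hθ₀⟩ := hCne
  obtain ⟨S₀, hS₀sub, hS₀m, hS₀⟩ : ∃ S₀ ⊆ {z | ContinuousOn (fun θ => m θ z) C},
      MeasurableSet S₀ ∧ μ S₀ᶜ = 0 := by
    obtain ⟨N, hN, hNm, hN0⟩ := exists_measurable_superset_of_null (ae_iff.1 hc)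
    refine ⟨Nᶜ, fun z hz => ?_, hNm.compl, by simpa using hN0⟩
    by_contra h
    exact hz (hN h)
  -- Setting the family to 0 off `S₀` makes it continuous in the parameter for every `z`, not just
  -- almost every one.
  let u : C → S → ℝ := fun θ => S₀.indicator (m θ)
  have hu : Measurable (Function.uncurry u) := by
    refine measurable_uncurry_of_continuous_of_measurable (fun z => ?_) fun θ =>
      (hm θ θ.2).indicator hS₀m
    by_cases hz : z ∈ S₀
    · simp only [u, Set.indicator_of_mem hz]
      exact continuousOn_iff_continuous_domRestrict.1 (hS₀sub hz)
    · simp only [u, Set.indicator_of_notMem hz]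
      exact continuous_const
  classical
  let t' : Ω → C := fun ω => if h : ht.mk t ω ∈ C then ⟨ht.mk t ω, h⟩ else ⟨θ₀, hθ₀⟩
  have ht' : Measurable t' := by
    have h : (fun ω => (t' ω : E)) = fun ω => if ht.mk t ω ∈ C then ht.mk t ω else θ₀ := by
      funext ω
      by_cases h : ht.mk t ω ∈ C <;> simp [t', h]
    refine (MeasurableEmbedding.subtype_coe hC).measurable_comp_iff.1 ?_
    refine Eq.subst (motive := fun g => Measurable g) h.symm ?_
    exact Measurable.ite (ht.measurable_mk hC) ht.measurable_mk measurable_const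
  refine ⟨fun ω => u (t' ω) (Z ω), hu.comp (ht'.prodMk hZ.measurable), ?_⟩
  have hZS : ∀ᵐ ω ∂P, Z ω ∈ S₀ := hZ.quasiMeasurePreserving.ae (p := fun z => z ∈ S₀)
    (by rw [ae_iff]; exact hS₀)
  filter_upwards [ht.ae_eq_mk, htC, hZS] with ω h1 h2 h3
  have h4 : ht.mk t ω ∈ C := h1 ▸ h2
  simp only [u, t', h4, dif_pos, Set.indicator_of_mem h3, h1]

/-! ### Limit theorems for functions of i.i.d. samples -/

section LimitTheorems

variable {Ω S : Type*} [MeasurableSpace Ω] [MeasurableSpace S] {P : Measure Ω}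
  {μ : Measure S} {Z : ℕ → Ω → S}

lemma identDistrib_comp_sample (hZ : ∀ i, MeasurePreserving (Z i) P μ) {F : Type*}
    [MeasurableSpace F] {g : S → F} (hg : Measurable g) (i j : ℕ) :
    IdentDistrib (fun ω => g (Z i ω)) (fun ω => g (Z j ω)) P P :=
  IdentDistrib.comp ⟨(hZ i).measurable.aemeasurable, (hZ j).measurable.aemeasurable,
    (hZ i).map_eq.trans (hZ j).map_eq.symm⟩ hg

lemma ae_forall_sample_eq (hZ : ∀ i, MeasurePreserving (Z i) P μ) {F : Type*} {g g' : S → F}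
    (h : g =ᵐ[μ] g') : ∀ᵐ ω ∂P, ∀ i, g (Z i ω) = g' (Z i ω) :=
  ae_all_iff.2 fun i => (hZ i).quasiMeasurePreserving.ae_eq_comp h

lemma integral_comp_sample {Z : Ω → S} (hZ : MeasurePreserving Z P μ) {F : Type*}
    [NormedAddCommGroup F] [NormedSpace ℝ F] {g : S → F} (hg : AEStronglyMeasurable g μ) :
    ∫ ω, g (Z ω) ∂P = ∫ z, g z ∂μ := by
  obtain ⟨hZm, rfl⟩ := hZ
  exact (integral_map hZm.aemeasurable hg).symm

lemma tendsto_average_sample [IsProbabilityMeasure P] (hind : iIndepFun Z P)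
    (hZ : ∀ i, MeasurePreserving (Z i) P μ) {F : Type*} [NormedAddCommGroup F] [NormedSpace ℝ F]
    [CompleteSpace F] [MeasurableSpace F] [BorelSpace F] {g : S → F} (hg : Integrable g μ) :
    ∀ᵐ ω ∂P, Tendsto (fun N : ℕ => (N : ℝ)⁻¹ • ∑ i ∈ Finset.range N, g (Z i ω)) atTop
      (𝓝 (∫ z, g z ∂μ)) := by
  have hg' := hg.congr hg.1.ae_eq_mk
  have hm : StronglyMeasurable (hg.1.mk g) := hg.1.stronglyMeasurable_mk
  have hlaw := strong_law_ae (μ := P) (fun i ω => hg.1.mk g (Z i ω))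
    ((hZ 0).integrable_comp_of_integrable hg')
    (fun i j hij => (hind.indepFun hij).comp hm.measurable hm.measurable)
    (fun i => identDistrib_comp_sample hZ hm.measurable i 0)
  have hint : ∫ ω, hg.1.mk g (Z 0 ω) ∂P = ∫ z, g z ∂μ := by
    rw [integral_congr_ae hg.1.ae_eq_mk, integral_comp_sample (hZ 0) hm.aestronglyMeasurable]
  filter_upwards [hlaw, ae_forall_sample_eq hZ hg.1.ae_eq_mk] with ω h1 h2
  rw [hint] at h1
  simpa [h2] using h1

/-- Sample averages of a dominated family that becomes uniformly small along `T n` are eventually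
uniformly small. -/
lemma ae_eventually_average_le [IsProbabilityMeasure P] (hind : iIndepFun Z P)
    (hZ : ∀ i, MeasurePreserving (Z i) P μ) {𝒯 : Type*} [TopologicalSpace 𝒯]
    [SecondCountableTopology 𝒯]
    (G : 𝒯 → S → ℝ) (T : ℕ → Set 𝒯) (hG : ∀ n, ∀ t ∈ T n, AEStronglyMeasurable (G t) μ)
    (hc : ∀ᵐ z ∂μ, ∀ n, ContinuousOn (fun t => G t z) (T n))
    {b : S → ℝ} (hb : Integrable b μ) (hGb : ∀ᵐ z ∂μ, ∀ n, ∀ t ∈ T n, |G t z| ≤ b z)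
    (hlim : ∀ᵐ z ∂μ, ∀ ε > 0, ∀ᶠ n in atTop, ∀ t ∈ T n, |G t z| ≤ ε) :
    ∀ᵐ ω ∂P, ∀ ε > 0, ∃ n, ∀ᶠ N : ℕ in atTop, ∀ t ∈ T n,
      |(N : ℝ)⁻¹ * ∑ i ∈ Finset.range N, G t (Z i ω)| ≤ ε := by
  have key : ∀ k : ℕ, ∀ᵐ ω ∂P, ∃ n, ∀ᶠ N : ℕ in atTop, ∀ t ∈ T n,
      |(N : ℝ)⁻¹ * ∑ i ∈ Finset.range N, G t (Z i ω)| ≤ 1 / ((k : ℝ) + 1) := by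
    intro k
    have hk : (0 : ℝ) < 1 / ((k : ℝ) + 1) := by positivity
    -- One envelope dominates all averages over `T n`, and the strong law applies to it; a mean of
    -- at most half the target leaves room for the fluctuation. Only countably many targets are
    -- used, so the null sets can be united.
    obtain ⟨n, g, hgi, hGg, hgε⟩ :=
      exists_envelope_integral_le G T hG hc hb hGb hlim (half_pos hk)
    have hall : ∀ᵐ ω ∂P, ∀ i, ∀ t ∈ T n, |G t (Z i ω)| ≤ g (Z i ω) :=
      ae_all_iff.2 fun i => (hZ i).quasiMeasurePreserving.ae hGg
    filter_upwards [tendsto_average_sample hind hZ hgi, hall] with ω h1 h2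
    refine ⟨n, ?_⟩
    filter_upwards [h1.eventually_lt_const (show _ < 1 / ((k : ℝ) + 1) by linarith)]
      with N hN t ht
    refine le_trans ?_ hN.le
    rw [abs_mul, abs_of_nonneg (by positivity : (0 : ℝ) ≤ (N : ℝ)⁻¹), smul_eq_mul]
    gcongr
    exact (Finset.abs_sum_le_sum_abs _ _).trans (Finset.sum_le_sum fun i _ => h2 i t ht)
  filter_upwards [ae_all_iff.2 key] with ω hω ε hε
  obtain ⟨k, hk⟩ := exists_nat_one_div_lt hε
  obtain ⟨n, hn⟩ := hω k
  exact ⟨n, hn.mono fun N hN t ht => (hN t ht).trans hk.le⟩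

/-- The multivariate central limit theorem for centred functions of i.i.d. samples. -/
lemma tendstoInDistribution_multivariateGaussian [IsProbabilityMeasure P]
    [IsProbabilityMeasure μ] (hind : iIndepFun Z P)
    (hZ : ∀ i, MeasurePreserving (Z i) P μ) {q : ℕ} {V : S → EuclideanSpace ℝ (Fin q)}
    (hV : MemLp V 2 μ) (hV0 : ∫ z, V z ∂μ = 0) {Q : Matrix (Fin q) (Fin q) ℝ}
    (hS : Q.PosSemidef)
    (hcov : ∀ t : EuclideanSpace ℝ (Fin q),
      ∫ z, (inner ℝ t (V z)) ^ 2 ∂μ = t.ofLp ⬝ᵥ Q.mulVec t.ofLp) :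
    TendstoInDistribution (fun (N : ℕ) ω => (√(N : ℝ))⁻¹ • ∑ i ∈ Finset.range N, V (Z i ω)) atTop
      id (fun _ => P) (multivariateGaussian 0 Q) := by
  have hVi : Integrable V μ := hV.integrable (by norm_num)
  have hVZ : ∀ i, AEMeasurable (fun ω => V (Z i ω)) P := fun i =>
    hV.1.aemeasurable.comp_quasiMeasurePreserving (hZ i).quasiMeasurePreserving
  have hmeas : ∀ N : ℕ, AEMeasurable
      (fun ω => (√(N : ℝ))⁻¹ • ∑ i ∈ Finset.range N, V (Z i ω)) P := fun N => by
    have := Finset.aemeasurable_fun_sum (Finset.range N) fun i _ => hVZ i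
    exact this.const_smul (√(N : ℝ))⁻¹
  refine ⟨hmeas, aemeasurable_id, ProbabilityMeasure.tendsto_iff_tendsto_charFun.2 fun t => ?_⟩
  simp only [ProbabilityMeasure.coe_mk, Measure.map_id]
  have hm : Measurable (hV.1.mk V) := hV.1.stronglyMeasurable_mk.measurable
  have hlin : Measurable fun v : EuclideanSpace ℝ (Fin q) => inner ℝ t v := by fun_prop
  -- Cramér–Wold: the characteristic function of the vector sum at `t` is that of the scalar sum of
  -- `g` at 1, which reduces the claim to the one-dimensional theorem.
  let g : S → ℝ := fun z => inner ℝ t (hV.1.mk V z)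
  have hg : Measurable g := hlin.comp hm
  have hgV : ∀ᵐ z ∂μ, g z = inner ℝ t (V z) := hV.1.ae_eq_mk.mono fun z hz => by simp [g, hz]
  have hgL : MemLp g 2 μ := (memLp_congr_ae hgV).2 (hV.const_inner t)
  have hg0 : ∫ z, g z ∂μ = 0 := by
    rw [integral_congr_ae hgV, integral_inner hVi, hV0, inner_zero_right]
  have hgZ : ∀ i, Measurable fun ω => g (Z i ω) := fun i => hg.comp (hZ i).measurable
  have hgZ0 : ∫ ω, g (Z 0 ω) ∂P = 0 := by
    rw [← hg0, integral_comp_sample (hZ 0) hg.aestronglyMeasurable]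
  have hvar : Var[fun ω => g (Z 0 ω); P] = t.ofLp ⬝ᵥ Q.mulVec t.ofLp := by
    rw [variance_of_integral_eq_zero (hgZ 0).aemeasurable hgZ0, ← hcov t,
      ← integral_congr_ae (hgV.mono fun z hz => congrArg (· ^ 2) hz : (fun z => g z ^ 2) =ᵐ[μ] _),
      ← integral_comp_sample (hZ 0) (hg.pow_const 2).aestronglyMeasurable]
  have hclt := tendstoInDistribution_inv_sqrt_mul_sum_sub (P := P)
    (P' := gaussianReal 0 (Var[fun ω => g (Z 0 ω); P]).toNNReal) (Y := id)
    (X := fun i ω => g (Z i ω)) HasLaw.id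
    (hgL.comp_measurePreserving (hZ 0)) (hind.comp (fun _ => g) fun _ => hg)
    (fun i => identDistrib_comp_sample hZ hg i 0)
  have hcf := ProbabilityMeasure.tendsto_iff_tendsto_charFun.1 hclt.tendsto 1
  simp only [ProbabilityMeasure.coe_mk, Measure.map_id, hgZ0, mul_zero, sub_zero] at hcf
  have hlimit : charFun (gaussianReal 0 (Var[fun ω => g (Z 0 ω); P]).toNNReal) 1 =
      charFun (multivariateGaussian 0 Q) t := by
    rw [charFun_gaussianReal, charFun_multivariateGaussian hS,
      Real.coe_toNNReal _ (variance_nonneg _ _), hvar]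
    simp
  rw [hlimit] at hcf
  refine hcf.congr fun N => ?_
  rw [charFun_apply, charFun_apply, integral_map (hmeas N) (by fun_prop), integral_map
    ((Finset.measurable_fun_sum _ fun i _ => hgZ i).const_mul _).aemeasurable
    (by fun_prop)]
  refine integral_congr_ae ?_
  filter_upwards [ae_forall_sample_eq hZ hV.1.ae_eq_mk] with ω hω
  have : inner ℝ ((√(N : ℝ))⁻¹ * ∑ i ∈ Finset.range N, g (Z i ω)) (1 : ℝ) =
      inner ℝ ((√(N : ℝ))⁻¹ • ∑ i ∈ Finset.range N, V (Z i ω)) t := by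
    simp only [g, ← hω]
    rw [inner_smul_left, sum_inner]
    simp [real_inner_comm t]
  rw [this]

end LimitTheorems

/-! ### Deterministic estimates for minimizers -/

/-- Mean value inequality for `t ↦ g(x + th) - t g'(x)h - t² A h h / 2`, whose derivative is the
linearization error of `g'` applied to `h`. Since `A` is arbitrary, the same bound serves for crude
domination and for sharp remainders. -/
lemma abs_sub_taylor_two_le {E : Type*} [NormedAddCommGroup E] [NormedSpace ℝ E] {g : E → ℝ}
    {g' : E → E →L[ℝ] ℝ} {A : E →L[ℝ] E →L[ℝ] ℝ} {x h : E} {c : ℝ} (hc : 0 ≤ c)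
    (hg : ∀ t ∈ Set.Icc (0 : ℝ) 1, HasFDerivAt g (g' (x + t • h)) (x + t • h))
    (hb : ∀ t ∈ Set.Icc (0 : ℝ) 1, ‖g' (x + t • h) - g' x - A (t • h)‖ ≤ c * ‖t • h‖) :
    |g (x + h) - g x - g' x h - A h h / 2| ≤ c * ‖h‖ ^ 2 := by
  have hder : ∀ t ∈ Set.Icc (0 : ℝ) 1, HasDerivAt
      (fun t : ℝ => g (x + t • h) - t * g' x h - t ^ 2 / 2 * A h h)
      ((g' (x + t • h) - g' x - A (t • h)) h) t := by
    intro t ht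
    have hline : HasDerivAt (fun t : ℝ => x + t • h) h t := by
      simpa using ((hasDerivAt_id t).smul_const h).const_add x
    have h1 := (hg t ht).comp_hasDerivAt t hline
    have h2 : HasDerivAt (fun t : ℝ => t * g' x h) (g' x h) t := by
      simpa using (hasDerivAt_id t).mul_const (g' x h)
    have h3 : HasDerivAt (fun t : ℝ => t ^ 2 / 2 * A h h) (t * A h h) t := by
      have := (((hasDerivAt_id t).pow 2).div_const 2).mul_const (A h h)
      simp only [id] at this
      convert! this using 1
      norm_num
    convert! (h1.sub h2).sub h3 using 1
    simp
  have := norm_image_sub_le_of_norm_deriv_le_segment_01' (C := c * ‖h‖ ^ 2)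
    (fun t ht => (hder t ht).hasDerivWithinAt) fun t ht => ?_
  · refine le_of_eq_of_le ?_ this
    rw [Real.norm_eq_abs]
    congr 1
    simp
    ring
  · have ht' := Set.Ico_subset_Icc_self ht
    refine (ContinuousLinearMap.le_opNorm _ _).trans ?_
    calc _ ≤ c * ‖t • h‖ * ‖h‖ := by gcongr; exact hb t ht'
      _ ≤ c * ‖h‖ * ‖h‖ := by
        gcongr
        rw [norm_smul, Real.norm_of_nonneg ht.1]
        exact mul_le_of_le_one_left (norm_nonneg _) ht.2.le
      _ = c * ‖h‖ ^ 2 := by ring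

/-- A near-minimizer `h` of a small perturbation of `h ↦ -A h₀ h + A h h / 2` has nearly the same
value as the minimizer `h₀`. -/
lemma exists_perturbed_argmin_bound {E : Type*} [NormedAddCommGroup E] [NormedSpace ℝ E]
    (A : E →L[ℝ] E →L[ℝ] ℝ) (hsymm : ∀ x y, A x y = A y x) {κ : ℝ} (hκ : 0 < κ)
    (hA : ∀ x, κ * ‖x‖ ^ 2 ≤ A x x) {η : ℝ} (hη : 0 < η) :
    ∃ ε > 0, ∀ (h₀ h : E) (v₀ v w : ℝ), |v - (-A h₀ h + A h h / 2)| ≤ ε * ‖h‖ ^ 2 →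
      |v₀ - (-A h₀ h₀ + A h₀ h₀ / 2)| ≤ ε * ‖h₀‖ ^ 2 → v ≤ v₀ →
      |w - A h h / 2| ≤ ε * ‖h‖ ^ 2 →
      |-v - A h₀ h₀ / 2| ≤ η * ‖h₀‖ ^ 2 ∧ |w - A h₀ h₀ / 2| ≤ η * ‖h₀‖ ^ 2 := by
  -- With `d = h - h₀`, the argument yields `‖d‖ ≤ δ‖h₀‖`; the errors then add up to at most `(κ/3 +
  -- 2‖A‖) δ ‖h₀‖²`.
  obtain ⟨δ, hδ0, hδ1, hδη⟩ : ∃ δ : ℝ, 0 < δ ∧ δ ≤ 1 ∧ (κ / 3 + 2 * ‖A‖) * δ ≤ η := by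
    have hpos : 0 < κ / 3 + 2 * ‖A‖ := by positivity
    refine ⟨min 1 (η / (κ / 3 + 2 * ‖A‖)), by positivity, min_le_left _ _, ?_⟩
    calc _ ≤ (κ / 3 + 2 * ‖A‖) * (η / (κ / 3 + 2 * ‖A‖)) := by gcongr; exact min_le_right _ _
      _ = η := by field_simp
  refine ⟨κ * δ ^ 2 / 12, by positivity, fun h₀ h v₀ v w hv hv₀ hle hw => ?_⟩
  obtain ⟨d, rfl⟩ : ∃ d, h = h₀ + d := ⟨h - h₀, by abel⟩
  have hδ2 : δ ^ 2 ≤ δ := by nlinarith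
  have hop : ∀ x y, |A x y| ≤ ‖A‖ * ‖x‖ * ‖y‖ := fun x y => A.le_opNorm₂ x y
  have htri : ‖h₀ + d‖ ≤ ‖h₀‖ + ‖d‖ := norm_add_le _ _
  have hn0 := norm_nonneg h₀
  have hnd := norm_nonneg d
  have hsq : ‖h₀ + d‖ ^ 2 ≤ 2 * ‖h₀‖ ^ 2 + 2 * ‖d‖ ^ 2 := by
    nlinarith [norm_nonneg (h₀ + d), sq_nonneg (‖h₀‖ - ‖d‖)]
  have hexp : A (h₀ + d) (h₀ + d) = A h₀ h₀ + 2 * A h₀ d + A d d := by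
    simp only [map_add, add_apply, hsymm d h₀]; ring
  have hexp' : A h₀ (h₀ + d) = A h₀ h₀ + A h₀ d := by simp
  rw [hexp, hexp'] at hv
  rw [hexp] at hw
  set a := A h₀ h₀
  set b := A h₀ d
  set ε := κ * δ ^ 2 / 12 with hε
  have hεκ : ε ≤ κ / 12 := by rw [hε]; nlinarith
  have hε0 : 0 ≤ ε := by positivity
  -- Completing the square, the unperturbed value at `h₀ + d` exceeds that at `h₀` by exactly `A d d
  -- / 2`; as `v ≤ v₀`, this excess is at most the two errors.
  have hdd : A d d / 2 ≤ ε * (‖h₀ + d‖ ^ 2 + ‖h₀‖ ^ 2) := by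
    have h1 := (abs_le.1 hv).1
    have h2 := (abs_le.1 hv₀).2
    linarith
  -- The factor 12 in `ε` lets coercivity absorb the `‖d‖²` part of the error: what remains is
  -- `κ‖d‖²/3 ≤ 3ε‖h₀‖² = κδ²‖h₀‖²/4`.
  have hd2 : ‖d‖ ^ 2 ≤ δ ^ 2 * ‖h₀‖ ^ 2 := by
    have h1 := hA d
    have h2 : ε * (‖h₀ + d‖ ^ 2 + ‖h₀‖ ^ 2) ≤ ε * (3 * ‖h₀‖ ^ 2) + κ / 12 * (2 * ‖d‖ ^ 2) := by
      nlinarith [mul_le_mul_of_nonneg_right hεκ (by positivity : 0 ≤ 2 * ‖d‖ ^ 2)]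
    have h3 : κ * ‖d‖ ^ 2 ≤ κ * (δ ^ 2 * ‖h₀‖ ^ 2) := by rw [hε] at h2; nlinarith
    exact le_of_mul_le_mul_left h3 hκ
  have hd : ‖d‖ ≤ δ * ‖h₀‖ := by
    rw [← mul_pow] at hd2
    exact (pow_le_pow_iff_left₀ hnd (by positivity) two_ne_zero).1 hd2
  have hh : ε * ‖h₀ + d‖ ^ 2 ≤ κ / 3 * δ * ‖h₀‖ ^ 2 := by
    have h1 : ‖h₀ + d‖ ≤ 2 * ‖h₀‖ := by nlinarith
    calc ε * ‖h₀ + d‖ ^ 2 ≤ ε * (2 * ‖h₀‖) ^ 2 := by gcongr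
      _ = κ / 3 * δ ^ 2 * ‖h₀‖ ^ 2 := by rw [hε]; ring
      _ ≤ κ / 3 * δ * ‖h₀‖ ^ 2 := by gcongr
  have hAdd : |A d d| ≤ ‖A‖ * δ * ‖h₀‖ ^ 2 := by
    calc |A d d| ≤ ‖A‖ * ‖d‖ * ‖d‖ := hop d d
      _ = ‖A‖ * ‖d‖ ^ 2 := by ring
      _ ≤ ‖A‖ * (δ ^ 2 * ‖h₀‖ ^ 2) := by gcongr
      _ ≤ ‖A‖ * (δ * ‖h₀‖ ^ 2) := by gcongr
      _ = _ := by ring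
  have hb : |b| ≤ ‖A‖ * δ * ‖h₀‖ ^ 2 := by
    calc |b| ≤ ‖A‖ * ‖h₀‖ * ‖d‖ := hop h₀ d
      _ ≤ ‖A‖ * ‖h₀‖ * (δ * ‖h₀‖) := by gcongr
      _ = _ := by ring
  have hfin : κ / 3 * δ * ‖h₀‖ ^ 2 + 2 * (‖A‖ * δ * ‖h₀‖ ^ 2) ≤ η * ‖h₀‖ ^ 2 := by
    calc _ = (κ / 3 + 2 * ‖A‖) * δ * ‖h₀‖ ^ 2 := by ring
      _ ≤ _ := by gcongr
  have hX : 0 ≤ ‖A‖ * δ * ‖h₀‖ ^ 2 := by positivity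
  rw [abs_le] at hv hw hAdd hb ⊢
  rw [abs_le]
  refine ⟨⟨?_, ?_⟩, ?_, ?_⟩ <;> linarith [hv.1, hv.2, hw.1, hw.2, hAdd.1, hAdd.2, hb.1, hb.2]

/-- Consistency of minimizers of asymptotically equicontinuous functions that converge on a dense
set. -/
lemma tendsto_argmin_of_equicontinuous {E : Type*} [PseudoMetricSpace E] {C D : Set E}
    (hC : IsCompact C) (hDC : D ⊆ C) (hD : C ⊆ closure D) {m : ℕ → E → ℝ} {M : E → ℝ}
    (hM : ContinuousOn M C) (hlim : ∀ t ∈ D, Tendsto (fun N => m N t) atTop (𝓝 (M t)))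
    (heq : ∀ ε > 0, ∃ δ > 0, ∀ᶠ N in atTop, ∀ s ∈ C, ∀ t ∈ C, dist s t < δ →
      |m N s - m N t| ≤ ε) {x₀ : E} (hx₀ : Tendsto (fun N => m N x₀) atTop (𝓝 (M x₀)))
    (huniq : ∀ t ∈ C, M t ≤ M x₀ → t = x₀) {x : ℕ → E}
    (hx : ∀ᶠ N in atTop, x N ∈ C ∧ m N (x N) ≤ m N x₀) : Tendsto x atTop (𝓝 x₀) := by
  -- By compactness it is enough that every cluster point `y` of the minimizers satisfies `M y ≤ M
  -- x₀`.
  refine hC.tendsto_nhds_of_unique_mapClusterPt (hx.mono fun _ h => h.1) fun y hy hcl =>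
    huniq y hy (le_of_forall_pos_le_add fun ε hε => ?_)
  obtain ⟨δ, hδ, hev⟩ := heq (ε / 2) (half_pos hε)
  obtain ⟨δ', hδ', hMy⟩ := Metric.continuousWithinAt_iff.1 (hM y hy) (ε / 2) (half_pos hε)
  obtain ⟨t, htD, hty⟩ := Metric.mem_closure_iff.1 (hD hy) (min (δ / 2) δ') (by positivity)
  have hfreq : ∃ᶠ N in atTop, dist (x N) y < δ / 2 :=
    hcl.frequently (Metric.ball_mem_nhds y (half_pos hδ))
  -- Otherwise `m N t > m N x₀ + ε/2` for large `N`. But for some such `N` the point `x N` is within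
  -- `δ` of `t`, so equicontinuity gives `m N t ≤ m N (x N) + ε/2 ≤ m N x₀ + ε/2`.
  have hmt : M t ≤ M x₀ + ε / 2 := by
    by_contra! hcon
    have h1 := ((hlim t htD).sub hx₀).eventually_const_lt (show ε / 2 < M t - M x₀ by linarith)
    obtain ⟨N, hN, h2, h3, h4, h5⟩ := (hfreq.and_eventually (h1.and (hev.and hx))).exists
    have h6 : dist t (x N) < δ := by
      calc dist t (x N) ≤ dist t y + dist y (x N) := dist_triangle _ _ _
        _ < δ / 2 + δ / 2 := by
          rw [dist_comm t y, dist_comm y (x N)]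
          exact add_lt_add (hty.trans_le (min_le_left _ _)) hN
        _ = δ := by ring
    have h7 := (abs_le.1 (h3 t (hDC htD) (x N) h4 h6)).2
    linarith
  have h8 := hMy (hDC htD) (by rw [dist_comm]; exact hty.trans_le (min_le_right _ _))
  rw [Real.dist_eq, abs_lt] at h8
  linarith [h8.1]

set_option maxSynthPendingDepth 3

/-! ### Asymptotics of minimizers of empirical means -/

/-- Dividing the error by `1 + ‖Zt‖²` gives `ρ → 0` almost surely. Slutsky and the continuous map
`(z, r) ↦ F z + r(1 + ‖z‖²)` then recover `W`; the summand 1 avoids division by zero. -/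
lemma tendstoInDistribution_of_abs_sub_le {Ω E : Type*} [MeasurableSpace Ω] {P : Measure Ω}
    [IsProbabilityMeasure P] [NormedAddCommGroup E] [MeasurableSpace E] [BorelSpace E]
    [SecondCountableTopology E] {γ : Measure E} [IsProbabilityMeasure γ] {Zt : ℕ → Ω → E}
    {W : ℕ → Ω → ℝ} {F : E → ℝ} (hF : Continuous F)
    (hZ : TendstoInDistribution Zt atTop id (fun _ => P) γ) (hW : ∀ N, AEMeasurable (W N) P)
    (h : ∀ᵐ ω ∂P, ∀ η > 0, ∀ᶠ N in atTop, |W N ω - F (Zt N ω)| ≤ η * ‖Zt N ω‖ ^ 2) :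
    TendstoInDistribution W atTop F (fun _ => P) γ := by
  let ρ : ℕ → Ω → ℝ := fun N ω => (W N ω - F (Zt N ω)) / (1 + ‖Zt N ω‖ ^ 2)
  have hρm : ∀ N, AEMeasurable (ρ N) P := fun N => by
    have h1 := hZ.forall_aemeasurable N
    exact ((hW N).sub (hF.measurable.comp_aemeasurable h1)).div
      ((h1.norm.pow_const 2).const_add 1)
  have hρ : ∀ᵐ ω ∂P, Tendsto (fun N => ρ N ω) atTop (𝓝 0) := by
    filter_upwards [h] with ω hω
    rw [Metric.tendsto_atTop']
    intro ε hε
    obtain ⟨N₀, hN₀⟩ := eventually_atTop.1 (hω (ε / 2) (half_pos hε))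
    refine ⟨N₀, fun N hN => ?_⟩
    have hpos : 0 < 1 + ‖Zt N ω‖ ^ 2 := by positivity
    rw [Real.dist_eq, sub_zero, abs_div, abs_of_pos hpos, div_lt_iff₀ hpos]
    have := hN₀ N hN.le
    nlinarith [sq_nonneg ‖Zt N ω‖]
  have hmeas : TendstoInMeasure P ρ atTop (fun _ => (0 : ℝ)) :=
    tendstoInMeasure_of_tendsto_ae (fun N => (hρm N).aestronglyMeasurable) hρ
  have hlim := hZ.continuous_comp_prodMk_of_tendstoInMeasure_const
    (g := fun p : E × ℝ => F p.1 + p.2 * (1 + ‖p.1‖ ^ 2)) (by fun_prop) hmeas hρm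
  refine hlim.congr (fun N => Eventually.of_forall fun ω => ?_)
    (Eventually.of_forall fun x => by simp)
  have hpos : 0 < 1 + ‖Zt N ω‖ ^ 2 := by positivity
  simp only [ρ]
  field_simp
  ring

/-- A loss function `m` that is continuous on `C` and twice continuously differentiable on `U`,
with integrable uniform bounds. -/
structure IsRegularLoss {E S : Type*} [NormedAddCommGroup E] [NormedSpace ℝ E] [MeasurableSpace S]
    (μ : Measure S) (m : E → S → ℝ) (C U : Set E) : Prop where
  measurable : ∀ θ, Measurable (m θ)
  continuousOn : ∀ᵐ z ∂μ, ContinuousOn (fun θ => m θ z) C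
  bound : ∃ b : S → ℝ, Integrable b μ ∧ ∀ᵐ z ∂μ, ∀ θ ∈ C, |m θ z| ≤ b z
  isOpen : IsOpen U
  subset : U ⊆ C
  contDiffOn : ∀ᵐ z ∂μ, ContDiffOn ℝ 2 (fun θ => m θ z) U
  bound_fderiv : ∃ b : S → ℝ, Integrable b μ ∧
    ∀ᵐ z ∂μ, ∀ θ ∈ U, ‖fderiv ℝ (fun θ => m θ z) θ‖ ≤ b z
  bound_fderiv_fderiv : ∃ b : S → ℝ, Integrable b μ ∧
    ∀ᵐ z ∂μ, ∀ θ ∈ U, ‖fderiv ℝ (fderiv ℝ (fun θ => m θ z)) θ‖ ≤ b z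

namespace IsRegularLoss

/-! ### Differentiation of the mean loss under the integral. -/

section Derivatives

variable {S : Type*} [MeasurableSpace S] {μ : Measure S} {q : ℕ}
  {m : EuclideanSpace ℝ (Fin q) → S → ℝ} {C U : Set (EuclideanSpace ℝ (Fin q))}

lemma hasFDerivAt (h : IsRegularLoss μ m C U) : ∀ᵐ z ∂μ, ∀ θ ∈ U,
    HasFDerivAt (fun θ => m θ z) (fderiv ℝ (fun θ => m θ z) θ) θ ∧
    HasFDerivAt (fderiv ℝ (fun θ => m θ z)) (fderiv ℝ (fderiv ℝ (fun θ => m θ z)) θ) θ := by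
  filter_upwards [h.contDiffOn] with z hz θ hθ
  have hU := h.isOpen.mem_nhds hθ
  have h1 := hz.fderiv_of_isOpen (m := 1) h.isOpen (by norm_num)
  exact ⟨((hz.differentiableOn (by norm_num)).differentiableAt hU).hasFDerivAt,
    ((h1.differentiableOn (by norm_num)).differentiableAt hU).hasFDerivAt⟩

lemma aestronglyMeasurable_fderiv (h : IsRegularLoss μ m C U) {θ : EuclideanSpace ℝ (Fin q)}
    (hθ : θ ∈ U) : AEStronglyMeasurable (fun z => fderiv ℝ (fun θ => m θ z) θ) μ :=
  aestronglyMeasurable_fderiv_param m (h.isOpen.mem_nhds hθ)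
    (fun t _ => (h.measurable t).aestronglyMeasurable)
    (h.hasFDerivAt.mono fun _ hz => (hz θ hθ).1.differentiableAt)

lemma aestronglyMeasurable_fderiv_fderiv (h : IsRegularLoss μ m C U)
    {θ : EuclideanSpace ℝ (Fin q)} (hθ : θ ∈ U) :
    AEStronglyMeasurable (fun z => fderiv ℝ (fderiv ℝ (fun θ => m θ z)) θ) μ :=
  aestronglyMeasurable_fderiv_param (fun θ z => fderiv ℝ (fun θ => m θ z) θ)
    (h.isOpen.mem_nhds hθ) (fun _ ht => h.aestronglyMeasurable_fderiv ht)
    (h.hasFDerivAt.mono fun _ hz => (hz θ hθ).2.differentiableAt)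

lemma integrable (h : IsRegularLoss μ m C U) {θ : EuclideanSpace ℝ (Fin q)} (hθ : θ ∈ C) :
    Integrable (m θ) μ := by
  obtain ⟨b, hb, hle⟩ := h.bound
  exact hb.mono' (h.measurable θ).aestronglyMeasurable (hle.mono fun z hz => hz θ hθ)

lemma integrable_fderiv (h : IsRegularLoss μ m C U) {θ : EuclideanSpace ℝ (Fin q)} (hθ : θ ∈ U) :
    Integrable (fun z => fderiv ℝ (fun θ => m θ z) θ) μ := by
  obtain ⟨b, hb, hle⟩ := h.bound_fderiv
  exact hb.mono' (h.aestronglyMeasurable_fderiv hθ) (hle.mono fun z hz => hz θ hθ)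

lemma integrable_fderiv_fderiv (h : IsRegularLoss μ m C U) {θ : EuclideanSpace ℝ (Fin q)}
    (hθ : θ ∈ U) : Integrable (fun z => fderiv ℝ (fderiv ℝ (fun θ => m θ z)) θ) μ := by
  obtain ⟨b, hb, hle⟩ := h.bound_fderiv_fderiv
  exact hb.mono' (h.aestronglyMeasurable_fderiv_fderiv hθ) (hle.mono fun z hz => hz θ hθ)

lemma continuousOn_integral (h : IsRegularLoss μ m C U) :
    ContinuousOn (fun θ => ∫ z, m θ z ∂μ) C := by
  obtain ⟨b, hb, hle⟩ := h.bound
  refine continuousOn_of_dominated (fun θ _ => (h.measurable θ).aestronglyMeasurable)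
    (fun θ hθ => hle.mono fun z hz => hz θ hθ) hb h.continuousOn

lemma hasFDerivAt_integral (h : IsRegularLoss μ m C U) {θ : EuclideanSpace ℝ (Fin q)}
    (hθ : θ ∈ U) :
    HasFDerivAt (fun θ => ∫ z, m θ z ∂μ) (∫ z, fderiv ℝ (fun θ => m θ z) θ ∂μ) θ := by
  obtain ⟨b, hb, hle⟩ := h.bound_fderiv
  exact hasFDerivAt_integral_of_dominated_of_fderiv_le (h.isOpen.mem_nhds hθ)
    (Eventually.of_forall fun t => (h.measurable t).aestronglyMeasurable)
    (h.integrable (h.subset hθ)) (h.aestronglyMeasurable_fderiv hθ) hle hb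
    (h.hasFDerivAt.mono fun z hz t ht => (hz t ht).1)

lemma hasFDerivAt_fderiv_integral (h : IsRegularLoss μ m C U) {θ : EuclideanSpace ℝ (Fin q)}
    (hθ : θ ∈ U) :
    HasFDerivAt (fderiv ℝ (fun θ => ∫ z, m θ z ∂μ))
      (∫ z, fderiv ℝ (fderiv ℝ (fun θ => m θ z)) θ ∂μ) θ := by
  obtain ⟨b, hb, hle⟩ := h.bound_fderiv_fderiv
  have hU := h.isOpen.mem_nhds hθ
  have h1 := hasFDerivAt_integral_of_dominated_of_fderiv_le (μ := μ) (𝕜 := ℝ)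
    (F := fun θ z => fderiv ℝ (fun θ => m θ z) θ)
    (F' := fun θ z => fderiv ℝ (fderiv ℝ (fun θ => m θ z)) θ) hU
    (by filter_upwards [hU] with t ht using h.aestronglyMeasurable_fderiv ht)
    (h.integrable_fderiv hθ) (h.aestronglyMeasurable_fderiv_fderiv hθ) hle hb
    (h.hasFDerivAt.mono fun z hz t ht => (hz t ht).2)
  refine h1.congr_of_eventuallyEq ?_
  filter_upwards [hU] with t ht using (h.hasFDerivAt_integral ht).fderiv

/-- The derivative of the mean loss is differentiable at `θs`, which bounds its linearization error
by `ε` times the distance on a ball; balls contain the segments that the Taylor estimate needs. -/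
lemma eventually_taylor_integral (h : IsRegularLoss μ m C U) {θs : EuclideanSpace ℝ (Fin q)}
    (hθ : θs ∈ U) (h0 : ∫ z, fderiv ℝ (fun θ => m θ z) θs ∂μ = 0) {ε : ℝ} (hε : 0 < ε) :
    ∀ᶠ θ in 𝓝 θs, |∫ z, m θ z ∂μ - ∫ z, m θs z ∂μ -
      (∫ z, fderiv ℝ (fderiv ℝ (fun θ => m θ z)) θs ∂μ) (θ - θs) (θ - θs) / 2| ≤
      ε * ‖θ - θs‖ ^ 2 := by
  have hD := (h.hasFDerivAt_fderiv_integral hθ).isLittleO.def hε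
  obtain ⟨r, hr, hball⟩ := Metric.eventually_nhds_iff_ball.1
    (hD.and (h.isOpen.mem_nhds hθ))
  filter_upwards [Metric.ball_mem_nhds θs hr] with θ hθr
  have hseg : ∀ t ∈ Set.Icc (0 : ℝ) 1, θs + t • (θ - θs) ∈ Metric.ball θs r := fun t ht =>
    (convex_ball θs r).add_smul_sub_mem (Metric.mem_ball_self hr) hθr ht
  have := abs_sub_taylor_two_le (x := θs) (h := θ - θs) hε.le
    (fun t ht => (h.hasFDerivAt_integral (hball _ (hseg t ht)).2).differentiableAt.hasFDerivAt)
    (fun t ht => by simpa using (hball _ (hseg t ht)).1)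
  rw [(h.hasFDerivAt_integral hθ).fderiv, h0] at this
  simpa using this

end Derivatives

end IsRegularLoss

namespace IsRegularLoss

/-! ### Uniform almost sure behaviour of empirical means. -/

section Sampling

variable {Ω S : Type*} [MeasurableSpace Ω] [MeasurableSpace S] {P : Measure Ω} {μ : Measure S}
  {Z : ℕ → Ω → S} {q : ℕ} {m : EuclideanSpace ℝ (Fin q) → S → ℝ}
  {C U : Set (EuclideanSpace ℝ (Fin q))}

/-- The differences `m s - m t`, indexed by pairs at distance below `1/(n+1)`, are dominated by `2b`
and become uniformly small by uniform continuity on the compact `C`, so `ae_eventually_average_le`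
applies. -/
lemma ae_equicontinuous_average [IsProbabilityMeasure P] (h : IsRegularLoss μ m C U)
    (hC : IsCompact C) (hind : iIndepFun Z P) (hZ : ∀ i, MeasurePreserving (Z i) P μ) :
    ∀ᵐ ω ∂P, ∀ ε > 0, ∃ δ > 0, ∀ᶠ N : ℕ in atTop, ∀ s ∈ C, ∀ t ∈ C, dist s t < δ →
      |(N : ℝ)⁻¹ * ∑ i ∈ Finset.range N, m s (Z i ω) -
        (N : ℝ)⁻¹ * ∑ i ∈ Finset.range N, m t (Z i ω)| ≤ ε := by
  obtain ⟨b, hb, hle⟩ := h.bound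
  have key := ae_eventually_average_le hind hZ
    (fun (p : EuclideanSpace ℝ (Fin q) × EuclideanSpace ℝ (Fin q)) z => m p.1 z - m p.2 z)
    (fun n => {p | p.1 ∈ C ∧ p.2 ∈ C ∧ dist p.1 p.2 < 1 / ((n : ℝ) + 1)})
    (fun n p _ => ((h.measurable p.1).sub (h.measurable p.2)).aestronglyMeasurable)
    (by
      filter_upwards [h.continuousOn] with z hz n
      exact (hz.comp continuousOn_fst fun p hp => hp.1).sub
        (hz.comp continuousOn_snd fun p hp => hp.2.1))
    (b := fun z => b z + b z) (hb.add hb)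
    (by
      filter_upwards [hle] with z hz n p hp
      exact (abs_sub _ _).trans (add_le_add (hz _ hp.1) (hz _ hp.2.1)))
    (by
      filter_upwards [h.continuousOn] with z hz ε hε
      obtain ⟨δ, hδ, hu⟩ := Metric.uniformContinuousOn_iff.1
        (hC.uniformContinuousOn_of_continuous hz) ε hε
      obtain ⟨k, hk⟩ := exists_nat_one_div_lt hδ
      filter_upwards [eventually_ge_atTop k] with n hn p hp
      refine (hu p.1 hp.1 p.2 hp.2.1 (hp.2.2.trans_le (le_trans ?_ hk.le))).le
      exact Nat.one_div_le_one_div hn)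
  filter_upwards [key] with ω hω ε hε
  obtain ⟨n, hn⟩ := hω ε hε
  refine ⟨1 / ((n : ℝ) + 1), by positivity, hn.mono fun N hN s hs t ht hst => ?_⟩
  have := hN (s, t) ⟨hs, ht, hst⟩
  rwa [Finset.sum_sub_distrib, mul_sub] at this

/-- The strong law is used only on a countable dense set of parameters, so that one null set
suffices; equicontinuity of the averages covers the other parameters. -/
lemma ae_tendsto_argmin [IsProbabilityMeasure P] (h : IsRegularLoss μ m C U)
    (hC : IsCompact C) (hind : iIndepFun Z P) (hZ : ∀ i, MeasurePreserving (Z i) P μ)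
    {θs : EuclideanSpace ℝ (Fin q)} (hθs : θs ∈ C)
    (huniq : ∀ t ∈ C, ∫ z, m t z ∂μ ≤ ∫ z, m θs z ∂μ → t = θs)
    {θN : ℕ → Ω → EuclideanSpace ℝ (Fin q)}
    (hθN : ∀ᵐ ω ∂P, ∀ N, 1 ≤ N → θN N ω ∈ C ∧
      IsMinOn (fun t => (N : ℝ)⁻¹ * ∑ i ∈ Finset.range N, m t (Z i ω)) C (θN N ω)) :
    ∀ᵐ ω ∂P, Tendsto (fun N => θN N ω) atTop (𝓝 θs) := by
  obtain ⟨D, hDC, hDc, hD⟩ := (TopologicalSpace.IsSeparable.of_separableSpace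
    C).exists_countable_dense_subset
  have hlim : ∀ᵐ ω ∂P, ∀ t ∈ D, Tendsto
      (fun N : ℕ => (N : ℝ)⁻¹ * ∑ i ∈ Finset.range N, m t (Z i ω)) atTop
      (𝓝 (∫ z, m t z ∂μ)) :=
    (ae_ball_iff hDc).2 fun t ht => tendsto_average_sample hind hZ (h.integrable (hDC ht))
  filter_upwards [hθN, hlim, tendsto_average_sample hind hZ (h.integrable hθs),
    h.ae_equicontinuous_average hC hind hZ] with ω h1 h2 h3 h4
  refine tendsto_argmin_of_equicontinuous hC hDC hD h.continuousOn_integral h2 h4 h3 huniq ?_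
  filter_upwards [eventually_ge_atTop 1] with N hN
  exact ⟨(h1 N hN).1, (h1 N hN).2 hθs⟩

/-- The empirical mean has a second-order expansion at `θs` that is uniform in the sample size. -/
lemma ae_average_taylor [IsProbabilityMeasure P] (h : IsRegularLoss μ m C U)
    (hind : iIndepFun Z P) (hZ : ∀ i, MeasurePreserving (Z i) P μ)
    {θs : EuclideanSpace ℝ (Fin q)} (hθs : θs ∈ U) :
    ∀ᵐ ω ∂P, ∀ ε > 0, ∃ r > 0, ∀ᶠ N : ℕ in atTop, ∀ θ ∈ Metric.ball θs r,
      |(N : ℝ)⁻¹ * ∑ i ∈ Finset.range N, m θ (Z i ω) -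
        (N : ℝ)⁻¹ * ∑ i ∈ Finset.range N, m θs (Z i ω) -
        ((N : ℝ)⁻¹ • ∑ i ∈ Finset.range N, fderiv ℝ (fun θ => m θ (Z i ω)) θs) (θ - θs) -
        (∫ z, fderiv ℝ (fderiv ℝ (fun θ => m θ z)) θs ∂μ) (θ - θs) (θ - θs) / 2| ≤
      ε * ‖θ - θs‖ ^ 2 := by
  obtain ⟨r, hr, hrU⟩ := Metric.isOpen_iff.1 h.isOpen θs hθs
  obtain ⟨b, hb, hle⟩ := h.bound_fderiv_fderiv
  -- The Taylor remainder `R`, divided by `‖θ - θs‖²`, is the family to be made uniformly small; the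
  -- sets `T n` are punctured balls so that the quotient is continuous.
  let R : EuclideanSpace ℝ (Fin q) → S → ℝ := fun θ z =>
    m θ z - m θs z - fderiv ℝ (fun θ => m θ z) θs (θ - θs) -
      fderiv ℝ (fderiv ℝ (fun θ => m θ z)) θs (θ - θs) (θ - θs) / 2
  let T : ℕ → Set (EuclideanSpace ℝ (Fin q)) := fun n =>
    {θ | θ ∈ Metric.ball θs (r / ((n : ℝ) + 1)) ∧ θ ≠ θs}
  have hTr : ∀ n, T n ⊆ Metric.ball θs r := fun n θ hθ =>
    Metric.ball_subset_ball (div_le_self hr.le (by linarith [n.cast_nonneg (α := ℝ)])) hθ.1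
  have hpos : ∀ n, ∀ θ ∈ T n, 0 < ‖θ - θs‖ ^ 2 := fun n θ hθ => by
    have := norm_pos_iff.2 (sub_ne_zero.2 hθ.2)
    positivity
  have hseg : ∀ {r' : ℝ} {θ}, 0 < r' → θ ∈ Metric.ball θs r' → ∀ t ∈ Set.Icc (0 : ℝ) 1,
      θs + t • (θ - θs) ∈ Metric.ball θs r' := fun {r'} {θ} hr' hθ t ht =>
    (convex_ball θs r').add_smul_sub_mem (Metric.mem_ball_self hr') hθ ht
  have hRm : ∀ n, ∀ θ ∈ T n, AEStronglyMeasurable (fun z => R θ z / ‖θ - θs‖ ^ 2) μ := by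
    intro n θ _
    have h1 := (h.aestronglyMeasurable_fderiv hθs).apply_continuousLinearMap (θ - θs)
    have h2 := ((h.aestronglyMeasurable_fderiv_fderiv hθs).apply_continuousLinearMap
      (θ - θs)).apply_continuousLinearMap (θ - θs)
    have h3 := (((h.measurable θ).aestronglyMeasurable (μ := μ)).sub
      (h.measurable θs).aestronglyMeasurable).sub h1
    exact ((h3.sub (h2.mul_const 2⁻¹)).mul_const (‖θ - θs‖ ^ 2)⁻¹)
  have hRc : ∀ᵐ z ∂μ, ∀ n, ContinuousOn (fun θ => R θ z / ‖θ - θs‖ ^ 2) (T n) := by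
    filter_upwards [h.continuousOn] with z hz n
    have h1 : ContinuousOn (fun θ => m θ z) (T n) :=
      hz.mono ((hTr n).trans (hrU.trans h.subset))
    refine ContinuousOn.div ?_ (by fun_prop) fun θ hθ => (hpos n θ hθ).ne'
    exact ((h1.sub continuousOn_const).sub (by fun_prop)).sub (by fun_prop)
  have hdiv : ∀ {c : ℝ} {n θ z}, θ ∈ T n → |R θ z| ≤ c * ‖θ - θs‖ ^ 2 →
      |R θ z / ‖θ - θs‖ ^ 2| ≤ c := fun {c n θ z} hθ hR => by
    rw [abs_div, abs_of_pos (hpos n θ hθ), div_le_iff₀ (hpos n θ hθ)]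
    exact hR
  have htaylor : ∀ᵐ z ∂μ, ∀ (c r' : ℝ), 0 ≤ c → 0 < r' → r' ≤ r →
      (∀ θ ∈ Metric.ball θs r', ‖fderiv ℝ (fun θ => m θ z) θ - fderiv ℝ (fun θ => m θ z) θs -
        fderiv ℝ (fderiv ℝ (fun θ => m θ z)) θs (θ - θs)‖ ≤ c * ‖θ - θs‖) →
      ∀ θ ∈ Metric.ball θs r', |R θ z| ≤ c * ‖θ - θs‖ ^ 2 := by
    filter_upwards [h.hasFDerivAt] with z hz c r' hc hr' hrr' hb θ hθ
    have := abs_sub_taylor_two_le (x := θs) (h := θ - θs)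
      (A := fderiv ℝ (fderiv ℝ (fun θ => m θ z)) θs) hc
      (fun t ht => (hz _ (hrU (Metric.ball_subset_ball hrr' (hseg hr' hθ t ht)))).1)
      (fun t ht => by simpa using hb _ (hseg hr' hθ t ht))
    simpa [R] using this
  have key := ae_eventually_average_le hind hZ (fun θ z => R θ z / ‖θ - θs‖ ^ 2) T hRm hRc
    (b := fun z => 2 * b z) (hb.const_mul 2)
    (by
      filter_upwards [htaylor, hle, h.hasFDerivAt] with z h1 h2 h3 n θ hθ
      have hb0 : 0 ≤ b z := (norm_nonneg _).trans (h2 θs hθs)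
      refine hdiv hθ (h1 (2 * b z) r (by positivity) hr le_rfl (fun θ hθ => ?_) θ (hTr n hθ))
      -- Domination: the increment of the derivative and the second-order term are each at most `b z
      -- * ‖θ - θs‖`, whence the bound `2 * b z`.
      have h4 := (convex_ball θs r).norm_image_sub_le_of_norm_fderiv_le (𝕜 := ℝ)
        (fun t ht => (h3 t (hrU ht)).2.differentiableAt) (fun t ht => h2 t (hrU ht))
        (Metric.mem_ball_self hr) hθ
      have h5 := (fderiv ℝ (fderiv ℝ (fun θ => m θ z)) θs).le_of_opNorm_le (h2 θs hθs) (θ - θs)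
      exact (norm_sub_le _ _).trans (by linarith))
    (by
      filter_upwards [htaylor, h.hasFDerivAt] with z h1 h2 ε hε
      obtain ⟨δ, hδ, hδ'⟩ := Metric.eventually_nhds_iff_ball.1 ((h2 θs hθs).2.isLittleO.def hε)
      have hlim : Tendsto (fun n : ℕ => r / ((n : ℝ) + 1)) atTop (𝓝 0) :=
        tendsto_const_nhds.div_atTop
          (tendsto_atTop_add_const_right _ _ tendsto_natCast_atTop_atTop)
      filter_upwards [hlim.eventually_lt_const (lt_min hδ hr)] with n hn θ hθ
      refine hdiv hθ (h1 ε (r / ((n : ℝ) + 1)) hε.le (by positivity)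
        (hn.le.trans (min_le_right _ _)) (fun θ hθ => ?_) θ hθ.1)
      exact hδ' θ (Metric.ball_subset_ball (hn.le.trans (min_le_left _ _)) hθ))
  filter_upwards [key, tendsto_average_sample hind hZ (h.integrable_fderiv_fderiv hθs)]
    with ω h1 h2 ε hε
  obtain ⟨n, hn⟩ := h1 (ε / 2) (half_pos hε)
  refine ⟨r / ((n : ℝ) + 1), by positivity, ?_⟩
  -- The remainder contributes `ε/2`. Replacing the empirical second derivative by its mean costs
  -- `ε`, halved by the factor 1/2 of the quadratic term.
  filter_upwards [hn, (tendsto_iff_norm_sub_tendsto_zero.1 h2).eventually_lt_const hε]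
    with N hN1 hN2 θ hθ
  rcases eq_or_ne θ θs with rfl | hne
  · simp
  have hp := hpos n θ ⟨hθ, hne⟩
  have h3 := hN1 θ ⟨hθ, hne⟩
  rw [← Finset.sum_div, ← mul_div_assoc, abs_div, abs_of_pos hp, div_le_iff₀ hp] at h3
  set A := ∫ z, fderiv ℝ (fderiv ℝ (fun θ => m θ z)) θs ∂μ
  set B := (N : ℝ)⁻¹ • ∑ i ∈ Finset.range N, fderiv ℝ (fderiv ℝ (fun θ => m θ (Z i ω))) θs with hB
  have h4 : |B (θ - θs) (θ - θs) - A (θ - θs) (θ - θs)| ≤ ε * ‖θ - θs‖ ^ 2 := by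
    calc _ = ‖(B - A) (θ - θs) (θ - θs)‖ := by simp
      _ ≤ ‖B - A‖ * ‖θ - θs‖ * ‖θ - θs‖ := (B - A).le_opNorm₂ _ _
      _ ≤ ε * ‖θ - θs‖ * ‖θ - θs‖ := by gcongr
      _ = _ := by ring
  have h5 : (N : ℝ)⁻¹ * ∑ i ∈ Finset.range N, R θ (Z i ω) =
      (N : ℝ)⁻¹ * ∑ i ∈ Finset.range N, m θ (Z i ω) -
        (N : ℝ)⁻¹ * ∑ i ∈ Finset.range N, m θs (Z i ω) -
        ((N : ℝ)⁻¹ • ∑ i ∈ Finset.range N, fderiv ℝ (fun θ => m θ (Z i ω)) θs) (θ - θs) -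
        B (θ - θs) (θ - θs) / 2 := by
    simp only [R, hB, Finset.sum_sub_distrib, smul_apply, sum_apply, smul_eq_mul,
      ← Finset.sum_div]
    ring
  rw [h5] at h3
  rw [abs_le] at h3 h4 ⊢
  constructor <;> linarith [h3.1, h3.2, h4.1, h4.2]

end Sampling

end IsRegularLoss

namespace IsRegularLoss

variable {Ω S : Type*} [MeasurableSpace Ω] [MeasurableSpace S] {P : Measure Ω} {μ : Measure S}
  {Z : ℕ → Ω → S} {q : ℕ} {m : EuclideanSpace ℝ (Fin q) → S → ℝ}
  {C U : Set (EuclideanSpace ℝ (Fin q))}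

/-- Pathwise, both excess losses of the empirical minimizer are equivalent to half the quadratic
form `A` at `h₀ = 2 N⁻¹ ∑ V(Z_i)`, where the gradient of the loss at `θs` is `-2 A V`. -/
lemma ae_excess_loss_approx [IsProbabilityMeasure P] (h : IsRegularLoss μ m C U)
    (hC : IsCompact C) (hind : iIndepFun Z P) (hZ : ∀ i, MeasurePreserving (Z i) P μ)
    {θs : EuclideanSpace ℝ (Fin q)} (hθs : θs ∈ U)
    (hmin : ∀ t ∈ C, ∫ z, m θs z ∂μ ≤ ∫ z, m t z ∂μ)
    (huniq : ∀ t ∈ C, ∫ z, m t z ∂μ ≤ ∫ z, m θs z ∂μ → t = θs)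
    {A : EuclideanSpace ℝ (Fin q) →L[ℝ] EuclideanSpace ℝ (Fin q) →L[ℝ] ℝ}
    (hAeq : ∫ z, fderiv ℝ (fderiv ℝ (fun θ => m θ z)) θs ∂μ = A)
    (hsymm : ∀ x y, A x y = A y x) {κ : ℝ} (hκ : 0 < κ) (hA : ∀ x, κ * ‖x‖ ^ 2 ≤ A x x)
    {V : S → EuclideanSpace ℝ (Fin q)} (hVi : Integrable V μ) (hV0 : ∫ z, V z ∂μ = 0)
    (hV : ∀ᵐ z ∂μ, ∀ x, fderiv ℝ (fun θ => m θ z) θs x = -(2 * A (V z) x))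
    {θN : ℕ → Ω → EuclideanSpace ℝ (Fin q)}
    (hθN : ∀ᵐ ω ∂P, ∀ N, 1 ≤ N → θN N ω ∈ C ∧
      IsMinOn (fun t => (N : ℝ)⁻¹ * ∑ i ∈ Finset.range N, m t (Z i ω)) C (θN N ω)) :
    ∀ᵐ ω ∂P, ∀ η > 0, ∀ᶠ N : ℕ in atTop, ∀ h₀,
      h₀ = (2 : ℝ) • (N : ℝ)⁻¹ • ∑ i ∈ Finset.range N, V (Z i ω) →
      |((N : ℝ)⁻¹ * ∑ i ∈ Finset.range N, m θs (Z i ω) -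
        (N : ℝ)⁻¹ * ∑ i ∈ Finset.range N, m (θN N ω) (Z i ω)) - A h₀ h₀ / 2| ≤ η * ‖h₀‖ ^ 2 ∧
      |(∫ z, m (θN N ω) z ∂μ - ∫ z, m θs z ∂μ) - A h₀ h₀ / 2| ≤ η * ‖h₀‖ ^ 2 := by
  have hUn := h.isOpen.mem_nhds hθs
  have hgrad : ∫ z, fderiv ℝ (fun θ => m θ z) θs ∂μ = 0 := by
    have hloc : IsLocalMin (fun θ => ∫ z, m θ z ∂μ) θs := by
      filter_upwards [hUn] with t ht using hmin t (h.subset ht)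
    exact hloc.hasFDerivAt_eq_zero (h.hasFDerivAt_integral hθs)
  have hVZ : ∀ᵐ ω ∂P, ∀ i, ∀ x, fderiv ℝ (fun θ => m θ (Z i ω)) θs x = -(2 * A (V (Z i ω)) x) :=
    ae_all_iff.2 fun i => (hZ i).quasiMeasurePreserving.ae hV
  filter_upwards [h.ae_tendsto_argmin hC hind hZ (h.subset hθs) huniq hθN,
    h.ae_average_taylor hind hZ hθs, tendsto_average_sample hind hZ hVi, hθN, hVZ]
    with ω hlim htay hVlim hmin' hVω η hη
  obtain ⟨ε, hε, hpert⟩ := exists_perturbed_argmin_bound A hsymm hκ hA hη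
  obtain ⟨r, hr, hev⟩ := htay ε hε
  have hlim2 : Tendsto (fun N : ℕ => θs + (2 : ℝ) • (N : ℝ)⁻¹ • ∑ i ∈ Finset.range N, V (Z i ω))
      atTop (𝓝 θs) := by
    have := (hVlim.const_smul (2 : ℝ)).const_add θs
    rwa [hV0, smul_zero, add_zero] at this
  filter_upwards [hev, eventually_ge_atTop 1, hlim.eventually (Metric.ball_mem_nhds θs hr),
    hlim2.eventually (Metric.ball_mem_nhds θs hr), hlim2.eventually hUn,
    hlim.eventually (h.eventually_taylor_integral hθs hgrad hε)]
    with N hN h1N hNr h0r h0U hNM h₀ hh₀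
  rw [← hh₀] at h0r h0U
  -- The empirical gradient at `θs` is `-A h₀`, so the quadratic model of the empirical loss is
  -- minimized exactly at `h₀`.
  have hlin : ∀ x, ((N : ℝ)⁻¹ • ∑ i ∈ Finset.range N, fderiv ℝ (fun θ => m θ (Z i ω)) θs) x =
      -A h₀ x := by
    intro x
    simp only [smul_apply, sum_apply, hVω, hh₀, map_smul, map_sum, smul_eq_mul,
      Finset.sum_neg_distrib, ← Finset.mul_sum]
    ring
  have e1 := hN (θN N ω) hNr
  have e2 := hN (θs + h₀) h0r
  -- By the strong law `h₀ → 0`, so `θs + h₀` eventually lies in `U`, hence in `C`, and is an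
  -- admissible competitor.
  have e3 := isMinOn_iff.1 (hmin' N h1N).2 (θs + h₀) (h.subset h0U)
  rw [hlin, hAeq] at e1 e2
  rw [hAeq] at hNM
  rw [add_sub_cancel_left] at e2
  have := hpert h₀ (θN N ω - θs)
    ((N : ℝ)⁻¹ * ∑ i ∈ Finset.range N, m (θs + h₀) (Z i ω) -
        (N : ℝ)⁻¹ * ∑ i ∈ Finset.range N, m θs (Z i ω))
    ((N : ℝ)⁻¹ * ∑ i ∈ Finset.range N, m (θN N ω) (Z i ω) -
        (N : ℝ)⁻¹ * ∑ i ∈ Finset.range N, m θs (Z i ω))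
    (∫ z, m (θN N ω) z ∂μ - ∫ z, m θs z ∂μ)
    (by convert! e1 using 2; ring) (by convert! e2 using 2; ring) (by linarith) hNM
  rwa [neg_sub] at this

/-- **Asymptotic distribution of the excess losses of an empirical minimizer.** -/
theorem tendstoInDistribution_excess_loss [IsProbabilityMeasure P] [IsProbabilityMeasure μ]
    (h : IsRegularLoss μ m C U)
    (hC : IsCompact C) (hind : iIndepFun Z P) (hZ : ∀ i, MeasurePreserving (Z i) P μ)
    {θs : EuclideanSpace ℝ (Fin q)} (hθs : θs ∈ U)
    (hmin : ∀ t ∈ C, ∫ z, m θs z ∂μ ≤ ∫ z, m t z ∂μ)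
    (huniq : ∀ t ∈ C, ∫ z, m t z ∂μ ≤ ∫ z, m θs z ∂μ → t = θs)
    {A : EuclideanSpace ℝ (Fin q) →L[ℝ] EuclideanSpace ℝ (Fin q) →L[ℝ] ℝ}
    (hAeq : ∫ z, fderiv ℝ (fderiv ℝ (fun θ => m θ z)) θs ∂μ = A)
    (hsymm : ∀ x y, A x y = A y x) {κ : ℝ} (hκ : 0 < κ) (hA : ∀ x, κ * ‖x‖ ^ 2 ≤ A x x)
    {V : S → EuclideanSpace ℝ (Fin q)} (hV2 : MemLp V 2 μ) (hV0 : ∫ z, V z ∂μ = 0)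
    (hV : ∀ᵐ z ∂μ, ∀ x, fderiv ℝ (fun θ => m θ z) θs x = -(2 * A (V z) x))
    {Q : Matrix (Fin q) (Fin q) ℝ} (hQ : Q.PosSemidef)
    (hcov : ∀ t : EuclideanSpace ℝ (Fin q),
      ∫ z, (inner ℝ t (V z)) ^ 2 ∂μ = t.ofLp ⬝ᵥ Q.mulVec t.ofLp)
    {θN : ℕ → Ω → EuclideanSpace ℝ (Fin q)} (hθN_meas : ∀ N, 1 ≤ N → AEMeasurable (θN N) P)
    (hθN : ∀ᵐ ω ∂P, ∀ N, 1 ≤ N → θN N ω ∈ C ∧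
      IsMinOn (fun t => (N : ℝ)⁻¹ * ∑ i ∈ Finset.range N, m t (Z i ω)) C (θN N ω)) :
    TendstoInDistribution
      (fun (N : ℕ) ω => (N : ℝ) * ((N : ℝ)⁻¹ * ∑ i ∈ Finset.range N, m θs (Z i ω) -
        (N : ℝ)⁻¹ * ∑ i ∈ Finset.range N, m (θN N ω) (Z i ω)))
      atTop (fun g => 2 * A g g) (fun _ => P) (multivariateGaussian 0 Q) ∧
    TendstoInDistribution
      (fun (N : ℕ) ω => (N : ℝ) * (∫ z, m (θN N ω) z ∂μ - ∫ z, m θs z ∂μ))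
      atTop (fun g => 2 * A g g) (fun _ => P) (multivariateGaussian 0 Q) := by
  have hclt := tendstoInDistribution_multivariateGaussian hind hZ hV2 hV0 hQ hcov
  have hF : Continuous fun g : EuclideanSpace ℝ (Fin q) => 2 * A g g := by fun_prop
  have hCne : C.Nonempty := ⟨θs, h.subset hθs⟩
  have hθNC : ∀ N, 1 ≤ N → ∀ᵐ ω ∂P, θN N ω ∈ C := fun N hN =>
    hθN.mono fun ω hω => (hω N hN).1
  have happ := h.ae_excess_loss_approx hC hind hZ hθs hmin huniq hAeq hsymm hκ hA
    (hV2.integrable (by norm_num)) hV0 hV hθN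
  -- With `v` the normalized sum of the central limit theorem, `√N h₀ = 2v`. Thus `N A h₀ h₀ / 2 = 2
  -- A v v`, and `N‖h₀‖² = 4‖v‖²` explains `η / 4`.
  have hscale : ∀ᵐ ω ∂P, ∀ η > 0, ∀ᶠ N : ℕ in atTop, ∀ w : ℝ, ∀ h₀,
      h₀ = (2 : ℝ) • (N : ℝ)⁻¹ • ∑ i ∈ Finset.range N, V (Z i ω) →
      |w - A h₀ h₀ / 2| ≤ η / 4 * ‖h₀‖ ^ 2 →
      |(N : ℝ) * w - 2 * A ((√(N : ℝ))⁻¹ • ∑ i ∈ Finset.range N, V (Z i ω))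
        ((√(N : ℝ))⁻¹ • ∑ i ∈ Finset.range N, V (Z i ω))| ≤
        η * ‖(√(N : ℝ))⁻¹ • ∑ i ∈ Finset.range N, V (Z i ω)‖ ^ 2 := by
    refine Eventually.of_forall fun ω η hη => ?_
    filter_upwards [eventually_ge_atTop 1] with N hN w h₀ hh₀ hw
    have hN0 : (0 : ℝ) < N := by exact_mod_cast hN
    have hsq : 0 < √(N : ℝ) := Real.sqrt_pos.2 hN0
    have hNsq : (N : ℝ) = √(N : ℝ) ^ 2 := (Real.sq_sqrt hN0.le).symm
    set v := (√(N : ℝ))⁻¹ • ∑ i ∈ Finset.range N, V (Z i ω) with hv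
    have h0v : h₀ = (2 * (√(N : ℝ))⁻¹) • v := by
      rw [hh₀, hv, smul_smul, smul_smul]
      congr 1
      rw [hNsq, Real.sqrt_sq hsq.le]
      field_simp
    have e1 : (N : ℝ) * (A h₀ h₀ / 2) = 2 * A v v := by
      rw [h0v]
      simp only [map_smul, smul_apply, smul_eq_mul]
      rw [hNsq, Real.sqrt_sq hsq.le]
      field_simp
    have e2 : (N : ℝ) * ‖h₀‖ ^ 2 = 4 * ‖v‖ ^ 2 := by
      rw [h0v, norm_smul, Real.norm_of_nonneg (by positivity)]
      rw [hNsq, Real.sqrt_sq hsq.le]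
      field_simp
      ring
    calc _ = (N : ℝ) * |w - A h₀ h₀ / 2| := by
          rw [← e1, ← mul_sub, abs_mul, abs_of_pos hN0]
      _ ≤ N * (η / 4 * ‖h₀‖ ^ 2) := by gcongr
      _ = η / 4 * (N * ‖h₀‖ ^ 2) := by ring
      _ = _ := by rw [e2]; ring
  constructor
  · refine tendstoInDistribution_of_abs_sub_le hF hclt (fun N => ?_) ?_
    -- At `N = 0` nothing is known about `θN`, but the prefactor `N` makes the variable zero.
    · rcases Nat.eq_zero_or_pos N with rfl | hN
      · simp
      have h1 := Finset.aemeasurable_fun_sum (μ := P) (Finset.range N) fun i _ =>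
        (h.measurable θs).comp_aemeasurable (hZ i).measurable.aemeasurable
      have h2 := Finset.aemeasurable_fun_sum (μ := P) (Finset.range N) fun i _ =>
        aemeasurable_eval_random_param hC.measurableSet hCne (fun θ _ => h.measurable θ)
          h.continuousOn (hZ i) (hθN_meas N hN) (hθNC N hN)
      exact ((h1.const_mul _).sub (h2.const_mul _)).const_mul _
    · filter_upwards [happ, hscale] with ω h1 h2 η hη
      filter_upwards [h1 (η / 4) (by positivity), h2 η hη] with N h3 h4
      exact h4 _ _ rfl (h3 _ rfl).1
  · refine tendstoInDistribution_of_abs_sub_le hF hclt (fun N => ?_) ?_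
    · rcases Nat.eq_zero_or_pos N with rfl | hN
      · simp
      have h1 := aemeasurable_eval_random_param (μ := P) (Z := id)
        (m := fun θ (_ : Ω) => ∫ z, m θ z ∂μ) hC.measurableSet hCne
        (fun θ _ => measurable_const) (Eventually.of_forall fun _ => h.continuousOn_integral)
        (MeasurePreserving.id P) (hθN_meas N hN) (hθNC N hN)
      exact (h1.sub_const _).const_mul _
    · filter_upwards [happ, hscale] with ω h1 h2 η hη
      filter_upwards [h1 (η / 4) (by positivity), h2 η hη] with N h3 h4
      exact h4 _ _ rfl (h3 _ rfl).2

end IsRegularLoss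

/-! ### Conditionally i.i.d. inner samples -/

lemma measurable_innerMean {p : ℕ} (K : ℕ) {f : EuclideanSpace ℝ (Fin p) → ℝ}
    (hf : Measurable f) : Measurable (innerMean K f) := by
  unfold innerMean
  fun_prop

/-- Bias-variance identity: under the product law the inner mean has expectation `∫ f` and, by
independence, variance `Var f / K`; the cross term integrates to zero. -/
lemma integral_sub_innerMean_sq {p : ℕ} {κ : Measure (EuclideanSpace ℝ (Fin p))}
    [IsProbabilityMeasure κ] {f : EuclideanSpace ℝ (Fin p) → ℝ} (hf : Measurable f)
    (hf2 : MemLp f 2 κ) {K : ℕ} (hK : 1 ≤ K) (c : ℝ) :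
    ∫ y, (c - innerMean K f y) ^ 2 ∂(Measure.infinitePi fun _ : ℕ => κ) =
      (c - ∫ y, f y ∂κ) ^ 2 + (K : ℝ)⁻¹ * ∫ y, (f y - ∫ y, f y ∂κ) ^ 2 ∂κ := by
  set η := Measure.infinitePi fun _ : ℕ => κ with hη
  have hK0 : (K : ℝ) ≠ 0 := by positivity
  have hmp : ∀ k : ℕ, MeasurePreserving (Function.eval k) η κ := fun k =>
    measurePreserving_eval_infinitePi (fun _ : ℕ => κ) k
  have hL : ∀ k : ℕ, MemLp (fun y : ℕ → EuclideanSpace ℝ (Fin p) => f (y k)) 2 η := fun k =>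
    hf2.comp_measurePreserving (hmp k)
  have hind : iIndepFun (fun (k : ℕ) (y : ℕ → EuclideanSpace ℝ (Fin p)) => f (y k)) η :=
    iIndepFun_infinitePi (P := fun _ : ℕ => κ) (X := fun _ => f) fun _ => hf
  have hE : ∀ k : ℕ, ∫ y, f (y k) ∂η = ∫ y, f y ∂κ := fun k =>
    integral_comp_sample (hmp k) hf.aestronglyMeasurable
  have hV : ∀ k : ℕ, Var[fun y => f (y k); η] = Var[f; κ] := fun k => by
    have := variance_map (μ := η) (X := f) (Y := Function.eval k)
      (by rw [(hmp k).map_eq]; exact hf.aemeasurable) (hmp k).measurable.aemeasurable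
    rw [(hmp k).map_eq] at this
    exact this.symm
  have hW : MemLp (innerMean K f) 2 η := (memLp_finsetSum _ fun k _ => hL k).const_mul _
  have hWE : ∫ y, innerMean K f y ∂η = ∫ y, f y ∂κ := by
    simp only [innerMean]
    rw [integral_const_mul, integral_finsetSum _ fun k _ => (hL k).integrable (by norm_num)]
    simp [hE, hK0]
  have hWV : Var[innerMean K f; η] = (K : ℝ)⁻¹ * Var[f; κ] := by
    have h1 := IndepFun.variance_sum (s := Finset.range K) (fun k _ => hL k)
      (fun i _ j _ hij => hind.indepFun hij)
    have h2 : innerMean K f = fun y => (K : ℝ)⁻¹ *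
        (∑ k ∈ Finset.range K, fun y : ℕ → EuclideanSpace ℝ (Fin p) => f (y k)) y := by
      funext y
      simp [innerMean]
    rw [h2, variance_const_mul, h1]
    simp only [hV, Finset.sum_const, Finset.card_range, nsmul_eq_mul]
    field_simp
  rw [← variance_eq_integral hf.aemeasurable, ← hWV,
    variance_eq_integral (measurable_innerMean K hf).aemeasurable, hWE]
  set e := ∫ y, f y ∂κ
  have hWi : Integrable (fun y => innerMean K f y - e) η :=
    (hW.integrable (by norm_num)).sub (integrable_const e)
  have hW2 : Integrable (fun y => (innerMean K f y - e) ^ 2) η :=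
    (hW.sub (memLp_const e)).integrable_sq
  have hexp : ∀ y, (c - innerMean K f y) ^ 2 =
      (c - e) ^ 2 - 2 * (c - e) * (innerMean K f y - e) + (innerMean K f y - e) ^ 2 := fun y => by
    ring
  simp_rw [hexp]
  have hWc : Integrable (fun y => 2 * (c - e) * (innerMean K f y - e)) η := hWi.const_mul _
  have hWd : Integrable (fun y => (c - e) ^ 2 - 2 * (c - e) * (innerMean K f y - e)) η :=
    (integrable_const _).sub hWc
  rw [integral_add hWd hW2, integral_sub (integrable_const _) hWc, integral_const_mul,
    integral_sub (hW.integrable (by norm_num)) (integrable_const e), hWE]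
  simp

section Conditional

variable {Ω : Type*} [MeasurableSpace Ω] {P : Measure Ω} [IsProbabilityMeasure P] {d p : ℕ}
  {X : Ω → EuclideanSpace ℝ (Fin d)} {Y : Ω → EuclideanSpace ℝ (Fin p)}
  {f : EuclideanSpace ℝ (Fin p) → ℝ} {Yc : ℕ → Ω → EuclideanSpace ℝ (Fin p)}

lemma condMean_ae_eq (hX : Measurable X) (hY : Measurable Y) (hf : Measurable f)
    (hf2 : Integrable (fun ω => f (Y ω) ^ 2) P) :
    condMean P X Y f =ᵐ[P] fun ω => ∫ y, f y ∂(condDistrib Y X P (X ω)) := by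
  have hL : MemLp (fun ω => f (Y ω)) 2 P :=
    (memLp_two_iff_integrable_sq (hf.comp hY).aestronglyMeasurable).2 hf2
  exact condExp_ae_eq_integral_condDistrib hX hY.aemeasurable hf.stronglyMeasurable
    (hL.integrable (by norm_num))

lemma ae_memLp_two_condDistrib (hX : Measurable X) (hY : Measurable Y) (hf : Measurable f)
    (hf2 : Integrable (fun ω => f (Y ω) ^ 2) P) :
    ∀ᵐ x ∂(P.map X), MemLp f 2 (condDistrib Y X P x) := by
  have hm : Measurable fun z : EuclideanSpace ℝ (Fin d) × EuclideanSpace ℝ (Fin p) =>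
      f z.2 ^ 2 := by fun_prop
  have h1 : Integrable (fun z : EuclideanSpace ℝ (Fin d) × EuclideanSpace ℝ (Fin p) => f z.2 ^ 2)
      (P.map X ⊗ₘ condDistrib Y X P) := by
    rw [compProd_map_condDistrib hY.aemeasurable]
    exact (integrable_map_measure hm.aestronglyMeasurable (hX.prodMk hY).aemeasurable).2 hf2
  filter_upwards [((Measure.integrable_compProd_iff hm.aestronglyMeasurable).1 h1).1] with x hx
  exact (memLp_two_iff_integrable_sq hf.aestronglyMeasurable).2 hx

/-- Given `X`, the law of one inner sample is a coordinate marginal of the product, namely `L(Y |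
X)`. This transfers square integrability from `f(Y)` to each `f(Y^{(k)})`. -/
lemma map_inner_sample_eq (hX : Measurable X) (hY : Measurable Y) (hYc : IsCondIID P X Y Yc)
    (k : ℕ) : P.map (Yc k) = P.map Y := by
  have hYcm : Measurable fun ω k => Yc k ω := measurable_pi_lambda _ hYc.measurable
  ext s hs
  have m1 : MeasurableSet {z : EuclideanSpace ℝ (Fin d) × (ℕ → EuclideanSpace ℝ (Fin p)) |
      z.2 k ∈ s} := ((measurable_pi_apply k).comp measurable_snd) hs
  have m2 : MeasurableSet {z : EuclideanSpace ℝ (Fin d) × EuclideanSpace ℝ (Fin p) | z.2 ∈ s} :=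
    measurable_snd hs
  have e1 : P.map (Yc k) s =
      (P.map fun ω => (X ω, fun k => Yc k ω)) {z | z.2 k ∈ s} := by
    rw [Measure.map_apply (hYc.measurable k) hs, Measure.map_apply (hX.prodMk hYcm) m1]
    rfl
  have e2 : P.map Y s = (P.map fun ω => (X ω, Y ω)) {z | z.2 ∈ s} := by
    rw [Measure.map_apply hY hs, Measure.map_apply (hX.prodMk hY) m2]
    rfl
  rw [e1, e2, ← compProd_map_condDistrib hYcm.aemeasurable,
    ← compProd_map_condDistrib hY.aemeasurable, Measure.compProd_apply m1,
    Measure.compProd_apply m2]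
  refine lintegral_congr_ae ?_
  filter_upwards [hYc.condLaw] with x hx
  rw [hx]
  exact (measurePreserving_eval_infinitePi (fun _ : ℕ => condDistrib Y X P x) k).measure_preimage
    hs.nullMeasurableSet

lemma memLp_two_innerMean (hX : Measurable X) (hY : Measurable Y) (hf : Measurable f)
    (hf2 : Integrable (fun ω => f (Y ω) ^ 2) P) (hYc : IsCondIID P X Y Yc) (K : ℕ) :
    MemLp (fun ω => innerMean K f fun k => Yc k ω) 2 P := by
  have hL : MemLp (fun ω => f (Y ω)) 2 P :=
    (memLp_two_iff_integrable_sq (hf.comp hY).aestronglyMeasurable).2 hf2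
  have hk : ∀ k, MemLp (fun ω => f (Yc k ω)) 2 P := fun k => by
    have h1 : MemLp f 2 (P.map Y) :=
      (memLp_map_measure_iff hf.aestronglyMeasurable hY.aemeasurable).2 hL
    rw [← map_inner_sample_eq hX hY hYc k] at h1
    exact (memLp_map_measure_iff hf.aestronglyMeasurable (hYc.measurable k).aemeasurable).1 h1
  exact (memLp_finsetSum _ fun k _ => hk k).const_mul _

/-- Conditional bias-variance decomposition of the nested squared error, with a weight depending on
the outer sample. -/
lemma integral_weighted_sub_innerMean_sq (hX : Measurable X) (hY : Measurable Y)
    (hf : Measurable f) (hf2 : Integrable (fun ω => f (Y ω) ^ 2) P) (hYc : IsCondIID P X Y Yc)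
    {K : ℕ} (hK : 1 ≤ K) {u h : EuclideanSpace ℝ (Fin d) → ℝ}
    (hu : AEStronglyMeasurable u (P.map X)) (hh : Measurable h)
    (hint : Integrable
      (fun ω => u (X ω) * (h (X ω) - innerMean K f fun k => Yc k ω) ^ 2) P) :
    ∫ ω, u (X ω) * (h (X ω) - innerMean K f fun k => Yc k ω) ^ 2 ∂P =
      ∫ ω, u (X ω) * (h (X ω) - condMean P X Y f ω) ^ 2 ∂P +
        (K : ℝ)⁻¹ * ∫ ω, u (X ω) * (f (Y ω) - condMean P X Y f ω) ^ 2 ∂P := by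
  -- The weights of interest are products of gradient coordinates, which are measurable only up to a
  -- null set.
  wlog hum : Measurable u generalizing u
  · have hue : ∀ᵐ ω ∂P, u (X ω) = hu.mk u (X ω) := ae_of_ae_map hX.aemeasurable hu.ae_eq_mk
    have hmk := hu.stronglyMeasurable_mk
    have hw := @this (hu.mk u) hmk.aestronglyMeasurable
      (hint.congr (hue.mono fun ω hω => by simp only [hω])) hmk.measurable
    have hA : ∀ F : Ω → ℝ, ∫ ω, u (X ω) * F ω ∂P = ∫ ω, hu.mk u (X ω) * F ω ∂P := fun F =>
      integral_congr_ae (hue.mono fun ω hω => congrArg (· * F ω) hω)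
    rw [hA fun ω => (h (X ω) - innerMean K f fun k => Yc k ω) ^ 2,
      hA fun ω => (h (X ω) - condMean P X Y f ω) ^ 2,
      hA fun ω => (f (Y ω) - condMean P X Y f ω) ^ 2]
    exact hw
  have hYcm : Measurable fun ω k => Yc k ω := measurable_pi_lambda _ hYc.measurable
  have hWm := measurable_innerMean K hf
  let g : EuclideanSpace ℝ (Fin d) → ℝ := fun x => ∫ y, f y ∂(condDistrib Y X P x)
  let v : EuclideanSpace ℝ (Fin d) → ℝ := fun x => ∫ y, (f y - g x) ^ 2 ∂(condDistrib Y X P x)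
  have hg : Measurable g := (hf.stronglyMeasurable.comp_measurable
    measurable_snd).integral_kernel_prod_right'.measurable
  have hv : Measurable v := by
    have : StronglyMeasurable fun z : EuclideanSpace ℝ (Fin d) × EuclideanSpace ℝ (Fin p) =>
        (f z.2 - g z.1) ^ 2 := by
      refine Measurable.stronglyMeasurable ?_
      fun_prop
    exact this.integral_kernel_prod_right'.measurable
  have hv0 : ∀ x, 0 ≤ v x := fun x => integral_nonneg fun y => sq_nonneg _
  have hcm := condMean_ae_eq hX hY hf hf2
  have hcond : ∀ᵐ x ∂(P.map X), ∀ c,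
      ∫ y, (c - innerMean K f y) ^ 2 ∂(condDistrib (fun ω k => Yc k ω) X P x) =
        (c - g x) ^ 2 + (K : ℝ)⁻¹ * v x := by
    filter_upwards [hYc.condLaw, ae_memLp_two_condDistrib hX hY hf hf2] with x hx hx2 c
    rw [hx, integral_sub_innerMean_sq hf hx2 hK]
  let Φ : EuclideanSpace ℝ (Fin d) × (ℕ → EuclideanSpace ℝ (Fin p)) → ℝ := fun z =>
    u z.1 * (h z.1 - innerMean K f z.2) ^ 2
  have hΦm : Measurable Φ := by fun_prop
  have hΦ : Integrable Φ (P.map X ⊗ₘ condDistrib (fun ω k => Yc k ω) X P) := by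
    rw [compProd_map_condDistrib hYcm.aemeasurable]
    exact (integrable_map_measure hΦm.aestronglyMeasurable (hX.prodMk hYcm).aemeasurable).2 hint
  -- Only the whole weighted residual is assumed integrable. Conditionally its absolute value is
  -- `|u|` times a sum of two nonnegative terms, so each term is integrable separately.
  have hnorm : Integrable (fun x => |u x| * ((h x - g x) ^ 2 + (K : ℝ)⁻¹ * v x)) (P.map X) := by
    refine ((Measure.integrable_compProd_iff hΦm.aestronglyMeasurable).1 hΦ).2.congr ?_
    filter_upwards [hcond] with x hx
    rw [← hx (h x), ← integral_const_mul]
    refine integral_congr_ae (Eventually.of_forall fun y => ?_)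
    simp [Φ]
  have hi1 : Integrable (fun x => u x * (h x - g x) ^ 2) (P.map X) := by
    refine hnorm.mono' (by fun_prop) (Eventually.of_forall fun x => ?_)
    rw [Real.norm_eq_abs, abs_mul, abs_of_nonneg (sq_nonneg (h x - g x))]
    gcongr
    exact le_add_of_nonneg_right (mul_nonneg (by positivity) (hv0 x))
  have hi2 : Integrable (fun x => (K : ℝ)⁻¹ * (u x * v x)) (P.map X) := by
    refine hnorm.mono' (by fun_prop) (Eventually.of_forall fun x => ?_)
    rw [Real.norm_eq_abs, abs_mul, abs_mul, abs_of_nonneg (hv0 x),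
      abs_of_nonneg (by positivity : 0 ≤ (K : ℝ)⁻¹), mul_left_comm]
    gcongr
    exact le_add_of_nonneg_left (sq_nonneg _)
  have hi3 : Integrable (fun x => u x * v x) (P.map X) := by
    have hK0 : (K : ℝ) ≠ 0 := by positivity
    refine (hi2.const_mul (K : ℝ)).congr (Eventually.of_forall fun x => ?_)
    simp only
    field_simp
  have eΓ : ∫ ω, u (X ω) * (h (X ω) - innerMean K f fun k => Yc k ω) ^ 2 ∂P =
      ∫ x, u x * (h x - g x) ^ 2 + (K : ℝ)⁻¹ * (u x * v x) ∂(P.map X) := by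
    have e1 : ∫ ω, Φ (X ω, fun k => Yc k ω) ∂P =
        ∫ z, Φ z ∂(P.map fun ω => (X ω, fun k => Yc k ω)) :=
      (integral_map (hX.prodMk hYcm).aemeasurable hΦm.aestronglyMeasurable).symm
    rw [show ∫ ω, u (X ω) * (h (X ω) - innerMean K f fun k => Yc k ω) ^ 2 ∂P =
      ∫ ω, Φ (X ω, fun k => Yc k ω) ∂P from rfl, e1,
      ← compProd_map_condDistrib hYcm.aemeasurable, Measure.integral_compProd hΦ]
    refine integral_congr_ae ?_
    filter_upwards [hcond] with x hx
    simp only [Φ]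
    rw [integral_const_mul, hx]
    ring
  have eA : ∫ ω, u (X ω) * (h (X ω) - condMean P X Y f ω) ^ 2 ∂P =
      ∫ x, u x * (h x - g x) ^ 2 ∂(P.map X) := by
    rw [integral_map hX.aemeasurable hi1.1]
    exact integral_congr_ae (hcm.mono fun ω hω => by simp only [hω, g])
  have eB : ∫ ω, u (X ω) * (f (Y ω) - condMean P X Y f ω) ^ 2 ∂P =
      ∫ x, u x * v x ∂(P.map X) := by
    let Ψ : EuclideanSpace ℝ (Fin d) × EuclideanSpace ℝ (Fin p) → ℝ := fun z =>
      u z.1 * (f z.2 - g z.1) ^ 2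
    have hΨm : Measurable Ψ := by fun_prop
    have hΨ : Integrable Ψ (P.map X ⊗ₘ condDistrib Y X P) := by
      rw [Measure.integrable_compProd_iff hΨm.aestronglyMeasurable]
      constructor
      · filter_upwards [ae_memLp_two_condDistrib hX hY hf hf2] with x hx
        exact (hx.sub (memLp_const (g x))).integrable_sq.const_mul (u x)
      · refine hi3.norm.congr (Eventually.of_forall fun x => ?_)
        simp only [Ψ, norm_mul, Real.norm_of_nonneg (hv0 x), norm_pow, Real.norm_eq_abs, sq_abs]
        rw [integral_const_mul]
    calc _ = ∫ ω, Ψ (X ω, Y ω) ∂P :=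
          integral_congr_ae (hcm.mono fun ω hω => by simp only [hω, g, Ψ])
      _ = ∫ z, Ψ z ∂(P.map fun ω => (X ω, Y ω)) :=
          (integral_map (hX.prodMk hY).aemeasurable hΨm.aestronglyMeasurable).symm
      _ = _ := by
          rw [← compProd_map_condDistrib hY.aemeasurable, Measure.integral_compProd hΨ]
          simp only [Ψ, integral_const_mul, v]
  rw [eΓ, eA, eB, integral_add hi1 hi2, integral_const_mul]

end Conditional

/-! ### Derivatives of the squared residual -/

section SquaredResidual

variable {E : Type*} [NormedAddCommGroup E] [NormedSpace ℝ E] {g : E → ℝ} {U : Set E}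

lemma hasFDerivAt_sub_const_sq {θ : E} (hg : DifferentiableAt ℝ g θ) (w : ℝ) :
    HasFDerivAt (fun θ => (g θ - w) ^ 2) ((2 * (g θ - w)) • fderiv ℝ g θ) θ := by
  have := (hg.hasFDerivAt.sub_const w).pow 2
  simpa using this

/-- By the product rule the second derivative is `2(g - w) D²g + 2 Dg ⊗ Dg`. -/
lemma norm_fderiv_fderiv_sub_const_sq_le (hU : IsOpen U) (hg : ContDiffOn ℝ 2 g U) (w : ℝ) {θ : E}
    (hθ : θ ∈ U) :
    ‖fderiv ℝ (fderiv ℝ (fun θ => (g θ - w) ^ 2)) θ‖ ≤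
      2 * |g θ - w| * ‖fderiv ℝ (fderiv ℝ g) θ‖ + 2 * ‖fderiv ℝ g θ‖ ^ 2 := by
  have hd : ∀ t ∈ U, DifferentiableAt ℝ g t := fun t ht =>
    (hg.differentiableOn (by norm_num)).differentiableAt (hU.mem_nhds ht)
  have hd2 : DifferentiableAt ℝ (fderiv ℝ g) θ :=
    ((hg.fderiv_of_isOpen (m := 1) hU (by norm_num)).differentiableOn
      (by norm_num)).differentiableAt (hU.mem_nhds hθ)
  have hev : fderiv ℝ (fun θ => (g θ - w) ^ 2) =ᶠ[𝓝 θ]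
      (fun θ => 2 * (g θ - w)) • fderiv ℝ g := by
    filter_upwards [hU.mem_nhds hθ] with t ht
    exact (hasFDerivAt_sub_const_sq (hd t ht) w).fderiv
  have h1 : HasFDerivAt (fun θ => 2 * (g θ - w)) ((2 : ℝ) • fderiv ℝ g θ) θ :=
    ((hd θ hθ).hasFDerivAt.sub_const w).const_mul 2
  rw [hev.fderiv_eq, (h1.smul hd2.hasFDerivAt).fderiv]
  refine (norm_add_le _ _).trans (add_le_add ?_ ?_)
  · rw [norm_smul]
    simp
  · rw [ContinuousLinearMap.norm_smulRight_apply, norm_smul]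
    simp [sq, mul_assoc]

/-- The moment assumptions are on derivatives within `C`, meaningful up to the boundary; at interior
points they are the ordinary derivatives used in the proof. -/
lemma enorm_iteratedFDerivWithin_two {C : Set E} {θ : E} (hC : C ∈ 𝓝 θ) :
    ‖iteratedFDerivWithin ℝ 2 g C θ‖ₑ = ‖fderiv ℝ (fderiv ℝ g) θ‖ₑ := by
  have h1 : C =ᶠ[𝓝 θ] Set.univ := eventuallyEq_univ.2 hC
  rw [iteratedFDerivWithin_congr_set h1, iteratedFDerivWithin_univ, ← ofReal_norm, ← ofReal_norm,
    ← norm_iteratedFDeriv_fderiv, norm_iteratedFDeriv_one]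

lemma enorm_gradientWithin {E : Type*} [NormedAddCommGroup E] [InnerProductSpace ℝ E]
    [CompleteSpace E] {g : E → ℝ} {C : Set E} {θ : E} (hC : C ∈ 𝓝 θ) :
    ‖gradientWithin g C θ‖ₑ = ‖fderiv ℝ g θ‖ₑ := by
  rw [gradientWithin, fderivWithin_of_mem_nhds hC, ← ofReal_norm, ← ofReal_norm,
    LinearIsometryEquiv.norm_map]

end SquaredResidual

/-- The law of one sample `(X, (Y^{(k)})_k)`. -/
noncomputable def sampleLaw {Ω : Type*} [MeasurableSpace Ω] {d p : ℕ} (P : Measure Ω)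
    (X : Ω → EuclideanSpace ℝ (Fin d)) (Yc : ℕ → Ω → EuclideanSpace ℝ (Fin p)) :
    Measure (EuclideanSpace ℝ (Fin d) × (ℕ → EuclideanSpace ℝ (Fin p))) :=
  P.map fun ω => (X ω, fun k => Yc k ω)

/-- The squared residual of the parameter `θ` at one sample. -/
noncomputable def nestedLoss {d p q : ℕ} (f : EuclideanSpace ℝ (Fin p) → ℝ)
    (φ : EuclideanSpace ℝ (Fin q) → EuclideanSpace ℝ (Fin d) → ℝ) (K : ℕ)
    (θ : EuclideanSpace ℝ (Fin q))
    (z : EuclideanSpace ℝ (Fin d) × (ℕ → EuclideanSpace ℝ (Fin p))) : ℝ :=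
  (φ θ z.1 - innerMean K f z.2) ^ 2

/-! ### Regularity and mean of the nested squared loss. -/

section NestedLoss

variable {Ω : Type*} [MeasurableSpace Ω] {P : Measure Ω} {d p q : ℕ}
  {X : Ω → EuclideanSpace ℝ (Fin d)} {Y : Ω → EuclideanSpace ℝ (Fin p)}
  {f : EuclideanSpace ℝ (Fin p) → ℝ} {Yc : ℕ → Ω → EuclideanSpace ℝ (Fin p)}
  {φ : EuclideanSpace ℝ (Fin q) → EuclideanSpace ℝ (Fin d) → ℝ}
  {C : Set (EuclideanSpace ℝ (Fin q))}

lemma measurePreserving_sampleLaw (hX : Measurable X) (hYc : ∀ k, Measurable (Yc k)) :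
    MeasurePreserving (fun ω => (X ω, fun k => Yc k ω)) P (sampleLaw P X Yc) :=
  ⟨hX.prodMk (measurable_pi_lambda _ hYc), rfl⟩

lemma measurePreserving_fst_sampleLaw (hX : Measurable X) (hYc : ∀ k, Measurable (Yc k)) :
    MeasurePreserving Prod.fst (sampleLaw P X Yc) (P.map X) := by
  refine ⟨measurable_fst, ?_⟩
  rw [sampleLaw, Measure.map_map measurable_fst (hX.prodMk (measurable_pi_lambda _ hYc))]
  rfl

lemma integral_sampleLaw (hX : Measurable X) (hYc : ∀ k, Measurable (Yc k))
    {F : EuclideanSpace ℝ (Fin d) × (ℕ → EuclideanSpace ℝ (Fin p)) → ℝ}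
    (hF : AEStronglyMeasurable F (sampleLaw P X Yc)) :
    ∫ z, F z ∂(sampleLaw P X Yc) = ∫ ω, F (X ω, fun k => Yc k ω) ∂P :=
  (integral_comp_sample (measurePreserving_sampleLaw hX hYc) hF).symm

lemma measurable_nestedLoss (hf : Measurable f) (hφ : ∀ θ, Measurable (φ θ)) (K : ℕ)
    (θ : EuclideanSpace ℝ (Fin q)) : Measurable (nestedLoss f φ K θ) := by
  have h1 := measurable_innerMean K hf
  have h2 := hφ θ
  unfold nestedLoss
  fun_prop

lemma ae_differentiableAt_interior (hC2 : ∀ᵐ x ∂(P.map X), ContDiffOn ℝ 2 (fun θ => φ θ x) C) :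
    ∀ᵐ x ∂(P.map X), ∀ θ ∈ interior C, DifferentiableAt ℝ (fun θ => φ θ x) θ ∧
      DifferentiableAt ℝ (fderiv ℝ (fun θ => φ θ x)) θ := by
  filter_upwards [hC2] with x hx θ hθ
  have hx' := hx.mono interior_subset
  have hn := isOpen_interior.mem_nhds hθ
  exact ⟨(hx'.differentiableOn (by norm_num)).differentiableAt hn,
    ((hx'.fderiv_of_isOpen (m := 1) isOpen_interior (by norm_num)).differentiableOn
      (by norm_num)).differentiableAt hn⟩

lemma aestronglyMeasurable_fderiv_family (hφ : ∀ θ, Measurable (φ θ))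
    (hC2 : ∀ᵐ x ∂(P.map X), ContDiffOn ℝ 2 (fun θ => φ θ x) C)
    {θ : EuclideanSpace ℝ (Fin q)} (hθ : θ ∈ interior C) :
    AEStronglyMeasurable (fun x => fderiv ℝ (fun θ => φ θ x) θ) (P.map X) :=
  aestronglyMeasurable_fderiv_param φ (isOpen_interior.mem_nhds hθ)
    (fun t _ => (hφ t).aestronglyMeasurable)
    ((ae_differentiableAt_interior hC2).mono fun _ hx => (hx θ hθ).1)

lemma aestronglyMeasurable_gradParam (hφ : ∀ θ, Measurable (φ θ))
    (hC2 : ∀ᵐ x ∂(P.map X), ContDiffOn ℝ 2 (fun θ => φ θ x) C)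
    {θ : EuclideanSpace ℝ (Fin q)} (hθ : θ ∈ interior C) :
    AEStronglyMeasurable (gradParam φ θ) (P.map X) :=
  (InnerProductSpace.toDual ℝ
    (EuclideanSpace ℝ (Fin q))).symm.continuous.comp_aestronglyMeasurable
      (aestronglyMeasurable_fderiv_family hφ hC2 hθ)

/-- The residual is dominated in L² by the envelope of `φ` plus the absolute inner mean. The loss
and its first two derivatives are sums of products of two factors bounded in L², hence have
integrable bounds. -/
lemma isRegularLoss_nestedLoss [IsProbabilityMeasure P] (hX : Measurable X) (hY : Measurable Y) (hf : Measurable f)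
    (hf2 : Integrable (fun ω => f (Y ω) ^ 2) P) (hφ : ∀ θ, Measurable (φ θ))
    (hYc : IsCondIID P X Y Yc)
    (hsup : ∫⁻ ω, ⨆ θ ∈ C, ‖φ θ (X ω)‖ₑ ^ 2 ∂P < ⊤)
    (hcont : ∀ᵐ x ∂(P.map X), ContinuousOn (fun θ => φ θ x) C)
    (hC2 : ∀ᵐ x ∂(P.map X), ContDiffOn ℝ 2 (fun θ => φ θ x) C)
    (hsup1 : ∫⁻ ω, ⨆ θ ∈ C, ‖gradientWithin (fun η => φ η (X ω)) C θ‖ₑ ^ 2 ∂P < ⊤)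
    (hsup2 : ∫⁻ ω, ⨆ θ ∈ C, ‖iteratedFDerivWithin ℝ 2 (fun η => φ η (X ω)) C θ‖ₑ ^ 2 ∂P < ⊤)
    (K : ℕ) :
    IsRegularLoss (sampleLaw P X Yc) (nestedLoss f φ K) C (interior C) := by
  have hfst := measurePreserving_fst_sampleLaw (P := P) hX hYc.measurable
  have hmp := measurePreserving_sampleLaw (P := P) hX hYc.measurable
  have hq := hfst.quasiMeasurePreserving
  have hdiff := ae_differentiableAt_interior hC2
  have hnhds : ∀ θ ∈ interior C, C ∈ 𝓝 θ := fun θ hθ => mem_interior_iff_mem_nhds.1 hθ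
  -- Since the supremum may not be measurable, passing to the law of `X` yields only an inequality
  -- (`lintegral_map_le`), in the direction needed.
  obtain ⟨b₀, hb₀, hb₀0, hb₀le⟩ := exists_memLp_two_bound (μ := P.map X) φ C
    (fun θ _ => (hφ θ).aestronglyMeasurable) hcont
    (s := fun x => ⨆ θ ∈ C, ‖φ θ x‖ₑ ^ 2)
    (Eventually.of_forall fun x θ hθ => le_iSup₂ (f := fun θ (_ : θ ∈ C) => ‖φ θ x‖ₑ ^ 2) θ hθ)
    ((lintegral_map_le _ _).trans_lt hsup)
  obtain ⟨b₁, hb₁, hb₁0, hb₁le⟩ := exists_memLp_two_bound (μ := P.map X)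
    (fun θ x => fderiv ℝ (fun θ => φ θ x) θ) (interior C)
    (fun θ hθ => aestronglyMeasurable_fderiv_family hφ hC2 hθ)
    (hdiff.mono fun x hx θ hθ => (hx θ hθ).2.continuousAt.continuousWithinAt)
    (s := fun x => ⨆ θ ∈ C, ‖gradientWithin (fun η => φ η x) C θ‖ₑ ^ 2)
    (Eventually.of_forall fun x θ hθ => by
      rw [← enorm_gradientWithin (hnhds θ hθ)]
      exact le_iSup₂ (f := fun θ (_ : θ ∈ C) => ‖gradientWithin (fun η => φ η x) C θ‖ₑ ^ 2) θ
        (interior_subset hθ))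
    ((lintegral_map_le _ _).trans_lt hsup1)
  obtain ⟨b₂, hb₂, hb₂0, hb₂le⟩ := exists_memLp_two_bound (μ := P.map X)
    (fun θ x => fderiv ℝ (fderiv ℝ (fun θ => φ θ x)) θ) (interior C)
    (fun θ hθ => aestronglyMeasurable_fderiv_param (fun θ x => fderiv ℝ (fun θ => φ θ x) θ)
      (isOpen_interior.mem_nhds hθ) (fun t ht => aestronglyMeasurable_fderiv_family hφ hC2 ht)
      (hdiff.mono fun x hx => (hx θ hθ).2))
    (by
      filter_upwards [hC2] with x hx
      have h1 := (hx.mono interior_subset).fderiv_of_isOpen (m := 1) isOpen_interior (by norm_num)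
      exact (h1.fderiv_of_isOpen (m := 0) isOpen_interior (by norm_num)).continuousOn)
    (s := fun x => ⨆ θ ∈ C, ‖iteratedFDerivWithin ℝ 2 (fun η => φ η x) C θ‖ₑ ^ 2)
    (Eventually.of_forall fun x θ hθ => by
      rw [← enorm_iteratedFDerivWithin_two (hnhds θ hθ)]
      exact le_iSup₂
        (f := fun θ (_ : θ ∈ C) => ‖iteratedFDerivWithin ℝ 2 (fun η => φ η x) C θ‖ₑ ^ 2) θ
        (interior_subset hθ))
    ((lintegral_map_le _ _).trans_lt hsup2)
  have hB₀ := hb₀.comp_measurePreserving hfst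
  have hB₁ := hb₁.comp_measurePreserving hfst
  have hB₂ := hb₂.comp_measurePreserving hfst
  have hWm : Measurable fun z : EuclideanSpace ℝ (Fin d) × (ℕ → EuclideanSpace ℝ (Fin p)) =>
      innerMean K f z.2 := (measurable_innerMean K hf).comp measurable_snd
  have hW : MemLp (fun z : EuclideanSpace ℝ (Fin d) × (ℕ → EuclideanSpace ℝ (Fin p)) =>
      |innerMean K f z.2|) 2 (sampleLaw P X Yc) :=
    ((memLp_map_measure_iff hWm.aestronglyMeasurable hmp.measurable.aemeasurable).2
      (memLp_two_innerMean hX hY hf hf2 hYc K)).abs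
  have hres : MemLp (fun z : EuclideanSpace ℝ (Fin d) × (ℕ → EuclideanSpace ℝ (Fin p)) =>
      b₀ z.1 + |innerMean K f z.2|) 2 (sampleLaw P X Yc) := hB₀.add hW
  have hresle : ∀ᵐ z ∂(sampleLaw P X Yc), ∀ θ ∈ C,
      |φ θ z.1 - innerMean K f z.2| ≤ b₀ z.1 + |innerMean K f z.2| := by
    filter_upwards [hq.ae hb₀le] with z hz θ hθ
    exact (abs_sub _ _).trans (add_le_add_left (hz θ hθ) _)
  refine ⟨measurable_nestedLoss hf hφ K, ?_, ⟨_, hres.integrable_sq, ?_⟩, isOpen_interior,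
    interior_subset, ?_, ⟨_, (hres.integrable_mul hB₁).const_mul 2, ?_⟩,
    ⟨_, ((hres.integrable_mul hB₂).const_mul 2).add (hB₁.integrable_sq.const_mul 2), ?_⟩⟩
  · filter_upwards [hq.ae hcont] with z hz
    exact (hz.sub continuousOn_const).pow 2
  · filter_upwards [hresle] with z hz θ hθ
    rw [nestedLoss, abs_of_nonneg (sq_nonneg _), ← sq_abs]
    gcongr
    exact hz θ hθ
  · filter_upwards [hq.ae hC2] with z hz
    exact ((hz.mono interior_subset).sub contDiffOn_const).pow 2
  · filter_upwards [hresle, hq.ae hb₁le, hq.ae hdiff] with z h1 h2 h3 θ hθ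
    have h4 := (hasFDerivAt_sub_const_sq (h3 θ hθ).1 (innerMean K f z.2)).fderiv
    simp only [nestedLoss]
    rw [h4, norm_smul, Real.norm_eq_abs, abs_mul, abs_two, mul_assoc]
    simp only [Pi.mul_apply, Function.comp_apply]
    have := h1 θ (interior_subset hθ)
    have := h2 θ hθ
    have := hb₀0 z.1
    gcongr
  · filter_upwards [hresle, hq.ae hb₁le, hq.ae hb₂le, hq.ae hC2] with z h1 h2 h3 h4 θ hθ
    refine (norm_fderiv_fderiv_sub_const_sq_le isOpen_interior (h4.mono interior_subset)
      (innerMean K f z.2) hθ).trans ?_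
    simp only [Pi.mul_apply, Pi.add_apply, Function.comp_apply]
    have := h1 θ (interior_subset hθ)
    have := h2 θ hθ
    have := h3 θ hθ
    have := hb₀0 z.1
    rw [mul_assoc]
    gcongr

/-- The expected nested loss differs from `v^∞` by a constant. -/
lemma integral_nestedLoss [IsProbabilityMeasure P] (hX : Measurable X) (hY : Measurable Y) (hf : Measurable f)
    (hf2 : Integrable (fun ω => f (Y ω) ^ 2) P) (hφ : ∀ θ, Measurable (φ θ))
    (hφ2 : ∀ θ, Integrable (fun ω => φ θ (X ω) ^ 2) P)
    (hYc : IsCondIID P X Y Yc) {K : ℕ} (hK : 1 ≤ K) (θ : EuclideanSpace ℝ (Fin q)) :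
    ∫ z, nestedLoss f φ K θ z ∂(sampleLaw P X Yc) =
      vInf P X Y f φ θ + (K : ℝ)⁻¹ * ∫ ω, (f (Y ω) - condMean P X Y f ω) ^ 2 ∂P := by
  rw [integral_sampleLaw hX hYc.measurable (measurable_nestedLoss hf hφ K θ).aestronglyMeasurable]
  have h1 : MemLp (fun ω => φ θ (X ω)) 2 P :=
    (memLp_two_iff_integrable_sq ((hφ θ).comp hX).aestronglyMeasurable).2 (hφ2 θ)
  have h2 := integral_weighted_sub_innerMean_sq hX hY hf hf2 hYc hK (u := fun _ => 1)
    aestronglyMeasurable_const (hφ θ)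
    (by simpa using (h1.sub (memLp_two_innerMean hX hY hf hf2 hYc K)).integrable_sq)
  simp only [one_mul] at h2
  exact h2

end NestedLoss

/-! ### Quadratic forms -/

lemma apply_eq_dotProduct_mulVec {q : ℕ}
    (A : EuclideanSpace ℝ (Fin q) →L[ℝ] EuclideanSpace ℝ (Fin q) →L[ℝ] ℝ)
    (H : Matrix (Fin q) (Fin q) ℝ)
    (hAH : ∀ i j, A (EuclideanSpace.single i 1) (EuclideanSpace.single j 1) = H i j)
    (x y : EuclideanSpace ℝ (Fin q)) : A x y = x.ofLp ⬝ᵥ H.mulVec y.ofLp := by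
  conv_lhs => rw [← (EuclideanSpace.basisFun (Fin q) ℝ).sum_repr x,
    ← (EuclideanSpace.basisFun (Fin q) ℝ).sum_repr y]
  simp only [map_sum, map_smul, sum_apply, smul_apply, EuclideanSpace.basisFun_apply,
    EuclideanSpace.basisFun_repr, hAH, dotProduct, Matrix.mulVec, smul_eq_mul, Finset.mul_sum]
  rw [Finset.sum_comm]
  exact Finset.sum_congr rfl fun i _ => Finset.sum_congr rfl fun j _ => by ring

/-- The constant is the minimum of the form on the unit sphere, which is compact; homogeneity does
the rest. The sphere is empty in dimension zero, where any constant works. -/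
lemma exists_coercivity_const {E : Type*} [NormedAddCommGroup E] [NormedSpace ℝ E]
    [FiniteDimensional ℝ E] (A : E →L[ℝ] E →L[ℝ] ℝ) (hA : ∀ x, x ≠ 0 → 0 < A x x) :
    ∃ κ > 0, ∀ x, κ * ‖x‖ ^ 2 ≤ A x x := by
  have := FiniteDimensional.proper ℝ E
  rcases (Metric.sphere (0 : E) 1).eq_empty_or_nonempty with he | hne
  · refine ⟨1, one_pos, fun x => ?_⟩
    have hx : x = 0 := by
      by_contra h
      have h1 : ‖x‖⁻¹ • x ∈ Metric.sphere (0 : E) 1 := by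
        simp [norm_smul, norm_ne_zero_iff.2 h]
      simp [he] at h1
    simp [hx]
  · obtain ⟨x₀, hx₀, hmin⟩ := (isCompact_sphere (0 : E) 1).exists_isMinOn hne
      (f := fun x => A x x) (by fun_prop)
    have h0 : x₀ ≠ 0 := by
      rintro rfl
      simp at hx₀
    refine ⟨A x₀ x₀, hA x₀ h0, fun x => ?_⟩
    rcases eq_or_ne x 0 with rfl | hx
    · simp
    have hn := norm_pos_iff.2 hx
    have h1 : ‖x‖⁻¹ • x ∈ Metric.sphere (0 : E) 1 := by simp [norm_smul, hn.ne']
    have h2 : A x₀ x₀ ≤ A (‖x‖⁻¹ • x) (‖x‖⁻¹ • x) := hmin h1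
    have h3 : A (‖x‖⁻¹ • x) (‖x‖⁻¹ • x) * ‖x‖ ^ 2 = A x x := by
      simp only [map_smul, smul_apply, smul_eq_mul]
      field_simp
    rw [← h3]
    gcongr

/-- The gradient of the mean loss vanishes at the interior minimizer, so `A` annihilates the mean of
`V`, and positivity of `A` forces that mean to be 0. This centres the central limit theorem. -/
lemma IsRegularLoss.integral_eq_zero_of_fderiv_eq {S : Type*} [MeasurableSpace S] {μ : Measure S}
    {q : ℕ} {m : EuclideanSpace ℝ (Fin q) → S → ℝ} {C U : Set (EuclideanSpace ℝ (Fin q))}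
    (h : IsRegularLoss μ m C U) {θs : EuclideanSpace ℝ (Fin q)} (hθs : θs ∈ U)
    (hmin : ∀ t ∈ C, ∫ z, m θs z ∂μ ≤ ∫ z, m t z ∂μ)
    {A : EuclideanSpace ℝ (Fin q) →L[ℝ] EuclideanSpace ℝ (Fin q) →L[ℝ] ℝ}
    (hA : ∀ x, x ≠ 0 → 0 < A x x)
    {V : S → EuclideanSpace ℝ (Fin q)} (hVi : Integrable V μ)
    (hV : ∀ᵐ z ∂μ, ∀ x, fderiv ℝ (fun θ => m θ z) θs x = -(2 * A (V z) x)) :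
    ∫ z, V z ∂μ = 0 := by
  have hloc : IsLocalMin (fun θ => ∫ z, m θ z ∂μ) θs := by
    filter_upwards [h.isOpen.mem_nhds hθs] with t ht using hmin t (h.subset ht)
  have hgrad := hloc.hasFDerivAt_eq_zero (h.hasFDerivAt_integral hθs)
  have h1 : ∫ z, fderiv ℝ (fun θ => m θ z) θs ∂μ = ((-2 : ℝ) • A) (∫ z, V z ∂μ) := by
    rw [← ContinuousLinearMap.integral_comp_comm _ hVi]
    refine integral_congr_ae (hV.mono fun z hz => ?_)
    ext x
    simp [hz x]
  by_contra hne
  have h2 := hA _ hne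
  have h3 := congrArg (fun L => L (∫ z, V z ∂μ)) (h1.symm.trans hgrad)
  simp at h3
  exact h2.ne' h3

/-! ### Weighted Gram matrices as covariances. -/

section Covariance

variable {Ω : Type*} [MeasurableSpace Ω] {P : Measure Ω} {d q : ℕ}
  {X : Ω → EuclideanSpace ℝ (Fin d)}
  {φ : EuclideanSpace ℝ (Fin q) → EuclideanSpace ℝ (Fin d) → ℝ} {θ : EuclideanSpace ℝ (Fin q)}
  {W : Ω → ℝ}

lemma integrable_sq_mul_coord (hW : AEStronglyMeasurable W P)
    (hg : AEStronglyMeasurable (fun ω => gradParam φ θ (X ω)) P)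
    (hint : Integrable (fun ω => W ω ^ 2 * ‖gradParam φ θ (X ω)‖ ^ 2) P) (i j : Fin q) :
    Integrable (fun ω => W ω ^ 2 * (gradParam φ θ (X ω) i * gradParam φ θ (X ω) j)) P := by
  have hc : ∀ i : Fin q, AEStronglyMeasurable (fun ω => gradParam φ θ (X ω) i) P := fun i =>
    (EuclideanSpace.proj (𝕜 := ℝ) i).continuous.comp_aestronglyMeasurable hg
  refine hint.mono' ((hW.pow 2).mul ((hc i).mul (hc j))) (Eventually.of_forall fun ω => ?_)
  have h1 := PiLp.norm_apply_le (gradParam φ θ (X ω))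
  rw [norm_mul, norm_pow, Real.norm_eq_abs, sq_abs, norm_mul, sq ‖gradParam φ θ (X ω)‖]
  gcongr <;> exact h1 _

lemma integral_sq_mul_inner_gradParam_sq (hW : AEStronglyMeasurable W P)
    (hg : AEStronglyMeasurable (fun ω => gradParam φ θ (X ω)) P)
    (hint : Integrable (fun ω => W ω ^ 2 * ‖gradParam φ θ (X ω)‖ ^ 2) P)
    (s : EuclideanSpace ℝ (Fin q)) :
    ∫ ω, W ω ^ 2 * inner ℝ s (gradParam φ θ (X ω)) ^ 2 ∂P =
      s.ofLp ⬝ᵥ (weightedGram P X φ θ W).mulVec s.ofLp := by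
  have hi := integrable_sq_mul_coord hW hg hint
  have hexp : ∀ ω, W ω ^ 2 * inner ℝ s (gradParam φ θ (X ω)) ^ 2 =
      ∑ i, ∑ j, s i * s j * (W ω ^ 2 * (gradParam φ θ (X ω) i * gradParam φ θ (X ω) j)) := by
    intro ω
    rw [EuclideanSpace.inner_eq_star_dotProduct]
    simp only [dotProduct, star_trivial]
    rw [sq (∑ i, _), Finset.sum_mul_sum, Finset.mul_sum]
    refine Finset.sum_congr rfl fun i _ => ?_
    rw [Finset.mul_sum]
    exact Finset.sum_congr rfl fun j _ => by ring
  simp_rw [hexp]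
  rw [integral_finsetSum _ fun i _ => integrable_finsetSum _ fun j _ => (hi i j).const_mul _]
  simp only [dotProduct, Matrix.mulVec, Finset.mul_sum, weightedGram, Matrix.of_apply]
  refine Finset.sum_congr rfl fun i _ => ?_
  rw [integral_finsetSum _ fun j _ => (hi i j).const_mul _]
  refine Finset.sum_congr rfl fun j _ => ?_
  rw [integral_const_mul]
  ring

lemma posSemidef_weightedGram (hW : AEStronglyMeasurable W P)
    (hg : AEStronglyMeasurable (fun ω => gradParam φ θ (X ω)) P)
    (hint : Integrable (fun ω => W ω ^ 2 * ‖gradParam φ θ (X ω)‖ ^ 2) P) :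
    (weightedGram P X φ θ W).PosSemidef := by
  refine Matrix.PosSemidef.of_dotProduct_mulVec_nonneg ?_ fun x => ?_
  · ext i j
    simp only [weightedGram, Matrix.conjTranspose_apply, Matrix.of_apply, star_trivial]
    exact integral_congr_ae (Eventually.of_forall fun ω => by simp only; ring)
  · have := integral_sq_mul_inner_gradParam_sq hW hg hint (WithLp.toLp 2 x)
    rw [star_trivial]
    rw [show x = (WithLp.toLp 2 x).ofLp from rfl, ← this]
    exact integral_nonneg fun ω => by positivity

end Covariance

end NestedRegression

/-! ### The general theorem applied to the nested loss. -/

theorem mainTheorem6 {Ω : Type*} [MeasurableSpace Ω] (P : Measure Ω) [IsProbabilityMeasure P]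
    {d p q : ℕ}
    -- the pair `(X, Y)`, the function `f` and the parametric family `φ`
    (X : Ω → EuclideanSpace ℝ (Fin d)) (hX : Measurable X)
    (Y : Ω → EuclideanSpace ℝ (Fin p)) (hY : Measurable Y)
    (f : EuclideanSpace ℝ (Fin p) → ℝ) (hf : Measurable f)
    (hf2 : Integrable (fun ω => f (Y ω) ^ 2) P)
    (φ : EuclideanSpace ℝ (Fin q) → EuclideanSpace ℝ (Fin d) → ℝ)
    (hφ : ∀ θ, Measurable (φ θ))
    (hφ2 : ∀ θ, Integrable (fun ω => φ θ (X ω) ^ 2) P)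
    -- the conditionally i.i.d. sequence `Y^{(k)}` and the samples `(X_i, Y_i^{(k)})`
    (Yc : ℕ → Ω → EuclideanSpace ℝ (Fin p)) (hYc : NestedRegression.IsCondIID P X Y Yc)
    (Xs : ℕ → Ω → EuclideanSpace ℝ (Fin d)) (Ys : ℕ → ℕ → Ω → EuclideanSpace ℝ (Fin p))
    (hsample : NestedRegression.IsIIDCopies P X Yc Xs Ys)
    -- the parameter set
    (C : Set (EuclideanSpace ℝ (Fin q))) (hC : IsCompact C) (hCne : (interior C).Nonempty)
    (hCconv : Convex ℝ C)
    -- uniform integrability and continuity on `C`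
    (hsup : ∫⁻ ω, ⨆ θ ∈ C, ‖φ θ (X ω)‖ₑ ^ 2 ∂P < ⊤)
    (hcont : ∀ᵐ x ∂(P.map X), ContinuousOn (fun θ => φ θ x) C)
    -- `θs` is the unique minimizer of `v^∞` on `C` and lies in the interior
    (θs : EuclideanSpace ℝ (Fin q)) (hθs : θs ∈ interior C)
    (hmin : IsMinOn (NestedRegression.vInf P X Y f φ) C θs)
    (huniq : ∀ θ ∈ C, IsMinOn (NestedRegression.vInf P X Y f φ) C θ → θ = θs)
    -- second-order smoothness on `C` with square-integrable suprema
    (hC2 : ∀ᵐ x ∂(P.map X), ContDiffOn ℝ 2 (fun θ => φ θ x) C)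
    (hsup1 : ∫⁻ ω, ⨆ θ ∈ C, ‖gradientWithin (fun η => φ η (X ω)) C θ‖ₑ ^ 2 ∂P < ⊤)
    (hsup2 : ∫⁻ ω, ⨆ θ ∈ C, ‖iteratedFDerivWithin ℝ 2 (fun η => φ η (X ω)) C θ‖ₑ ^ 2 ∂P < ⊤)
    -- the fixed number of inner samples, and the moment and nondegeneracy conditions
    (K : ℕ) (hK : 1 ≤ K)
    (hmom : Integrable (fun ω =>
      (φ θs (X ω) - NestedRegression.innerMean K f (fun k => Yc k ω)) ^ 2 *
        ‖NestedRegression.gradParam φ θs (X ω)‖ ^ 2) P)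
    (hH : (NestedRegression.hessian (NestedRegression.vInf P X Y f φ) θs).PosDef)
    -- `θN N` is a random minimizer of `v_N^K` on `C`
    (θN : ℕ → Ω → EuclideanSpace ℝ (Fin q))
    (hθN_meas : ∀ N, 1 ≤ N → AEMeasurable (θN N) P)
    (hθN : ∀ N, 1 ≤ N → ∀ᵐ ω ∂P, θN N ω ∈ C ∧
      IsMinOn (NestedRegression.vEmp f φ Xs Ys K N ω) C (θN N ω)) :
    let H := NestedRegression.hessian (NestedRegression.vInf P X Y f φ) θs
    let Γ := NestedRegression.matΓ P X Yc f φ K θs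
    Γ = NestedRegression.matA P X Y f φ θs +
        (K : ℝ)⁻¹ • NestedRegression.matB P X Y f φ θs ∧
    TendstoInDistribution
      (fun (N : ℕ) ω => (N : ℝ) * (NestedRegression.vEmp f φ Xs Ys K N ω θs -
        NestedRegression.vEmp f φ Xs Ys K N ω (θN N ω)))
      atTop (NestedRegression.twiceQuadForm H) (fun _ => P)
      (multivariateGaussian 0 (H⁻¹ * Γ * H⁻¹)) ∧
    TendstoInDistribution
      (fun (N : ℕ) ω => (N : ℝ) * (NestedRegression.vInf P X Y f φ (θN N ω) -
        NestedRegression.vInf P X Y f φ θs))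
      atTop (NestedRegression.twiceQuadForm H) (fun _ => P)
      (multivariateGaussian 0 (H⁻¹ * Γ * H⁻¹)) := by
  intro H Γ
  have hθC : θs ∈ C := interior_subset hθs
  have hYcm := hYc.measurable
  set μ := NestedRegression.sampleLaw P X Yc with hμ
  set m := NestedRegression.nestedLoss f φ K with hm
  have hmp := NestedRegression.measurePreserving_sampleLaw (P := P) hX hYcm
  have hfst := NestedRegression.measurePreserving_fst_sampleLaw (P := P) hX hYcm
  have : IsProbabilityMeasure μ := Measure.isProbabilityMeasure_map hmp.measurable.aemeasurable
  have hreg : NestedRegression.IsRegularLoss μ m C (interior C) :=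
    NestedRegression.isRegularLoss_nestedLoss hX hY hf hf2 hφ hYc hsup hcont hC2 hsup1 hsup2 K
  set c := (K : ℝ)⁻¹ * ∫ ω, (f (Y ω) - NestedRegression.condMean P X Y f ω) ^ 2 ∂P
  have hM : ∀ θ, ∫ z, m θ z ∂μ = NestedRegression.vInf P X Y f φ θ + c :=
    NestedRegression.integral_nestedLoss hX hY hf hf2 hφ hφ2 hYc hK
  have hminM : ∀ t ∈ C, ∫ z, m θs z ∂μ ≤ ∫ z, m t z ∂μ := fun t ht => by
    rw [hM, hM]
    exact add_le_add_left (isMinOn_iff.1 hmin t ht) c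
  have huniqM : ∀ t ∈ C, ∫ z, m t z ∂μ ≤ ∫ z, m θs z ∂μ → t = θs := fun t ht hle => by
    rw [hM, hM] at hle
    exact huniq t ht (isMinOn_iff.2 fun s hs =>
      (le_of_add_le_add_right hle).trans (isMinOn_iff.1 hmin s hs))
  -- the Hessian of `v^∞` as the mean of the second derivative of the loss
  set A := ∫ z, fderiv ℝ (fderiv ℝ (fun θ => m θ z)) θs ∂μ with hA
  have hAH : ∀ x y : EuclideanSpace ℝ (Fin q), A x y = x.ofLp ⬝ᵥ H.mulVec y.ofLp := by
    refine NestedRegression.apply_eq_dotProduct_mulVec A H fun i j => ?_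
    -- `v^∞` and the mean loss differ by the constant `c`, so their Hessians agree.
    have h1 : NestedRegression.vInf P X Y f φ = fun θ => ∫ z, m θ z ∂μ - c := by
      funext θ
      rw [hM, add_sub_cancel_right]
    have h2 : fderiv ℝ (NestedRegression.vInf P X Y f φ) = fderiv ℝ fun θ => ∫ z, m θ z ∂μ := by
      rw [h1]
      funext θ
      exact fderiv_sub_const c
    simp only [H, NestedRegression.hessian, Matrix.of_apply, iteratedFDeriv_two_apply, h2,
      (hreg.hasFDerivAt_fderiv_integral hθs).fderiv]
    rfl
  have hHt : H.transpose = H := hH.isHermitian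
  have hsymm : ∀ x y, A x y = A y x := fun x y => by
    rw [hAH, hAH, Matrix.dotProduct_mulVec, ← Matrix.mulVec_transpose, hHt, dotProduct_comm]
  have hpos : ∀ x, x ≠ 0 → 0 < A x x := fun x hx => by
    rw [hAH]
    have h1 : x.ofLp ≠ 0 := fun h => hx (by ext i; simp [h])
    simpa using hH.dotProduct_mulVec_pos h1
  obtain ⟨κ, hκ, hcoer⟩ := NestedRegression.exists_coercivity_const A hpos
  have hHdet : IsUnit H.det := (Matrix.isUnit_iff_isUnit_det H).1 hH.isUnit
  -- the weighted residual gradient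
  let W : Ω → ℝ := fun ω => φ θs (X ω) - NestedRegression.innerMean K f fun k => Yc k ω
  have hinner := NestedRegression.measurable_innerMean K hf
  have hWm : Measurable W := ((hφ θs).comp hX).sub
    (hinner.comp (measurable_pi_lambda _ hYcm))
  have hgν := NestedRegression.aestronglyMeasurable_gradParam hφ hC2 hθs
  have hg : AEStronglyMeasurable (fun ω => NestedRegression.gradParam φ θs (X ω)) P :=
    hgν.comp_measurable hX
  have hΓ := NestedRegression.posSemidef_weightedGram hWm.aestronglyMeasurable hg hmom
  have hcoord := NestedRegression.integrable_sq_mul_coord hWm.aestronglyMeasurable hg hmom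
  let L : EuclideanSpace ℝ (Fin q) →L[ℝ] EuclideanSpace ℝ (Fin q) :=
    Matrix.toEuclideanCLM (𝕜 := ℝ) H⁻¹
  have hL : ∀ x, (L x).ofLp = H⁻¹.mulVec x.ofLp := Matrix.ofLp_toEuclideanCLM H⁻¹
  let R : EuclideanSpace ℝ (Fin d) × (ℕ → EuclideanSpace ℝ (Fin p)) →
      EuclideanSpace ℝ (Fin q) := fun z =>
    (φ θs z.1 - NestedRegression.innerMean K f z.2) • NestedRegression.gradParam φ θs z.1
  -- The gradient of the loss at `θs` is `2R`, so `V = -H⁻¹R` is the choice for which it equals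
  -- `-2HV`; the covariance of `V` is then `H⁻¹ΓH⁻¹`.
  let V : EuclideanSpace ℝ (Fin d) × (ℕ → EuclideanSpace ℝ (Fin p)) →
      EuclideanSpace ℝ (Fin q) := fun z => -L (R z)
  have hres : Measurable fun z : EuclideanSpace ℝ (Fin d) × (ℕ → EuclideanSpace ℝ (Fin p)) =>
      φ θs z.1 - NestedRegression.innerMean K f z.2 :=
    ((hφ θs).comp measurable_fst).sub (hinner.comp measurable_snd)
  have hRm : AEStronglyMeasurable R μ :=
    hres.aestronglyMeasurable.smul (hgν.comp_measurePreserving hfst)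
  have hR2 : MemLp R 2 μ := by
    rw [hμ, NestedRegression.sampleLaw, memLp_map_measure_iff hRm hmp.measurable.aemeasurable,
      memLp_two_iff_integrable_sq_norm (hRm.comp_measurePreserving hmp)]
    refine hmom.congr (Eventually.of_forall fun ω => ?_)
    simp only [R, Function.comp_apply, norm_smul, mul_pow, Real.norm_eq_abs, sq_abs]
  have hV2 : MemLp V 2 μ := (L.comp_memLp' hR2).neg
  have hVgrad : ∀ᵐ z ∂μ, ∀ x, fderiv ℝ (fun θ => m θ z) θs x = -(2 * A (V z) x) := by
    filter_upwards [hfst.quasiMeasurePreserving.ae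
      (NestedRegression.ae_differentiableAt_interior hC2)] with z hz x
    have h1 := (NestedRegression.hasFDerivAt_sub_const_sq (hz θs hθs).1
      (NestedRegression.innerMean K f z.2)).fderiv
    simp only [hm, NestedRegression.nestedLoss]
    rw [h1, smul_apply, ← inner_gradient_left, hsymm, hAH]
    simp only [V, WithLp.ofLp_neg, hL, Matrix.mulVec_neg, Matrix.mulVec_mulVec,
      Matrix.mul_nonsing_inv H hHdet, Matrix.one_mulVec, dotProduct_neg]
    simp only [R, WithLp.ofLp_smul, dotProduct_smul, smul_eq_mul,
      EuclideanSpace.inner_eq_star_dotProduct, star_trivial, NestedRegression.gradParam]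
    ring
  have hV0 : ∫ z, V z ∂μ = 0 := hreg.integral_eq_zero_of_fderiv_eq hθs hminM hpos
    (hV2.integrable (by norm_num)) hVgrad
  have hinvt : H⁻¹.transpose = H⁻¹ := by rw [Matrix.transpose_nonsing_inv, hHt]
  have hcov : ∀ t : EuclideanSpace ℝ (Fin q),
      ∫ z, (inner ℝ t (V z)) ^ 2 ∂μ = t.ofLp ⬝ᵥ (H⁻¹ * Γ * H⁻¹).mulVec t.ofLp := by
    intro t
    have hadj : ∀ x, inner ℝ t (L x) = inner ℝ (L t) x := fun x => by
      simp only [EuclideanSpace.inner_eq_star_dotProduct, star_trivial, hL]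
      rw [dotProduct_comm, Matrix.dotProduct_mulVec, ← Matrix.mulVec_transpose, hinvt,
        dotProduct_comm]
    have h1 : AEStronglyMeasurable (fun z => inner ℝ t (V z) ^ 2) μ :=
      (hV2.1.const_inner.pow 2)
    rw [NestedRegression.integral_sampleLaw hX hYcm h1]
    have h2 := NestedRegression.integral_sq_mul_inner_gradParam_sq hWm.aestronglyMeasurable hg
      hmom (L t)
    have h3 : (L t).ofLp ⬝ᵥ Γ.mulVec (L t).ofLp =
        t.ofLp ⬝ᵥ (H⁻¹ * Γ * H⁻¹).mulVec t.ofLp := by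
      rw [hL, ← Matrix.mulVec_mulVec, ← Matrix.mulVec_mulVec, Matrix.dotProduct_mulVec t.ofLp,
        ← Matrix.mulVec_transpose, hinvt]
    rw [← h3]
    refine Eq.trans (integral_congr_ae (Eventually.of_forall fun ω => ?_)) h2
    simp only [V, R, inner_neg_right, hadj, inner_smul_right, W]
    ring
  have hQ : (H⁻¹ * Γ * H⁻¹).PosSemidef := by
    have := hΓ.conjTranspose_mul_mul_same H⁻¹
    rwa [Matrix.conjTranspose_eq_transpose_of_trivial, hinvt] at this
  have hlimit : (fun g => 2 * A g g) = NestedRegression.twiceQuadForm H := by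
    funext g
    rw [hAH, NestedRegression.twiceQuadForm]
  -- the samples
  have hZ : ∀ i, MeasurePreserving (fun ω => (Xs i ω, fun k => Ys i k ω)) P μ := fun i =>
    ⟨(hsample.measurable_outer i).prodMk (measurable_pi_lambda _ (hsample.measurable_inner i)),
      (hsample.identDistrib i).map_eq⟩
  have hθN' : ∀ᵐ ω ∂P, ∀ N, 1 ≤ N → θN N ω ∈ C ∧
      IsMinOn (NestedRegression.vEmp f φ Xs Ys K N ω) C (θN N ω) :=
    ae_all_iff.2 fun N => by
      by_cases hN : 1 ≤ N
      · exact (hθN N hN).mono fun _ h _ => h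
      · exact Eventually.of_forall fun _ h => absurd h hN
  have hmain := hreg.tendstoInDistribution_excess_loss hC hsample.indep hZ hθs hminM huniqM
    hA.symm hsymm hκ hcoer hV2 hV0 hVgrad hQ hcov hθN_meas hθN'
  rw [hlimit] at hmain
  refine ⟨?_, hmain.1, ?_⟩
  -- Entrywise, this is the conditional bias-variance decomposition with weight `∂ᵢφ ∂ⱼφ`.
  · ext i j
    have hu : AEStronglyMeasurable (fun x => NestedRegression.gradParam φ θs x i *
        NestedRegression.gradParam φ θs x j) (P.map X) :=
      ((EuclideanSpace.proj (𝕜 := ℝ) i).continuous.comp_aestronglyMeasurable hgν).mul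
        ((EuclideanSpace.proj (𝕜 := ℝ) j).continuous.comp_aestronglyMeasurable hgν)
    have h1 := NestedRegression.integral_weighted_sub_innerMean_sq hX hY hf hf2 hYc hK hu (hφ θs)
      ((hcoord i j).congr (Eventually.of_forall fun ω => mul_comm _ _))
    simpa only [Γ, NestedRegression.matΓ, NestedRegression.matA, NestedRegression.matB,
      NestedRegression.weightedGram, Matrix.add_apply, Matrix.smul_apply, Matrix.of_apply,
      smul_eq_mul, mul_comm] using h1
  · refine hmain.2.congr (fun N => Eventually.of_forall fun ω => ?_)
      (Eventually.of_forall fun _ => rfl)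
    simp only [hM, add_sub_add_right_eq_sub]
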